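/- Let $n\ge 1$, let $\Omega\subset\mathbb R^n$ be open. **Notation.** For $\xi\in\mathbb R^n\setminus\{0\}$ let $\Pi^\xi$ be the hyperplane through $0$ orthogonal to $\xi$; for $E\subset\mathbb R^n$ and $y\in\mathbb R^n$ let $E^\xi_y=\{t\in\mathbb R: y+t\xi\in E\}$, and for a function $u:\Omega\to\mathbb R^n$ let $\hat u^\xi_y(t)=u(y+t\xi)\cdot\xi$ for $t\in\Omega^\xi_y$. For an open set $A\subset\mathbb R$, $BV_{loc}(A)$ is the set of the functions $v\in L^1_{loc}(A)$ whose distributional derivative $Dv$ is a (real) Radon measure on $A$; $|Dv|$ is its total variation measure, and $\nabla v$ is the density of the absolutely continuous part of $Dv$ with respect to the Lebesgue measure $\mathcal L^1$. Let $J^1_v$ be the set of the points $t\in A$ at which the one-sided approximate limits $v^\pm(t)$ exist and $|v^+(t)-v^-(t)|>1$. Here $a$ is the approximate limit of $f$ at $x$, written $\operatorname{ap\,lim}_{y\to x}f(y)=a$, if for every $\varepsilon>0$ the set $\{|f-a|>\varepsilon\}$ has density $0$ at $x$ (one-sided approximate limits on $\mathbb R$ are defined in the same way, with the set intersected with a half-line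 starting at $x$). **The space.** An $\mathcal L^n$-measurable function $u:\Omega\to\mathbb R^n$ belongs to $\mathrm{GBV}^{\mathcal E}(\Omega;\mathbb R^n)$ if $\hat u^\xi_y\in BV_{loc}(\Omega^\xi_y)$ for $\mathcal H^{n-1}$-a.e. $\xi\in\mathbb S^{n-1}$ and $\mathcal H^{n-1}$-a.e. $y\in\Pi^\xi$, and if there is a finite positive Borel measure $\lambda$ on $\Omega$ such that for every open set $U\subset\Omega$ $$\int_{\mathbb S^{n-1}}\Big(\int_{\Pi^\xi}|D\hat u^\xi_y|(U^\xi_y\setminus J^1_{\hat u^\xi_y})+\mathcal H^0(U^\xi_y\cap J^1_{\hat u^\xi_y})\,d\mathcal H^{n-1}(y)\Big)d\mathcal H^{n-1}(\xi)\le\lambda(U).$$ **Theorem.** Let $u\in \mathrm{GBV}^{\mathcal E}(\Omega;\mathbb R^n)$. Then there exists $e(u)\in L^1(\Omega;\mathbb M^{n\times n}_{sym})$ such that $$\operatorname*{ap\,lim}_{y\to x}\frac{(u(y)-u(x)-e(u)(x)(y-x))\cdot(y-x)}{|y-x|^2}=0\quad\text{for a.e. }x\in\Omega.$$ Moreover,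 for a.e. $\xi\in\mathbb R^n\setminus\{0\}$ and for $\mathcal H^{n-1}$-a.e. $y\in\Pi^\xi$ one has $\hat u^\xi_y\in BV_{loc}(\Omega^\xi_y)$ and $$e(u)(y+t\xi)\,\xi\cdot\xi=\nabla\hat u^\xi_y(t)\quad\text{for }\mathcal L^1\text{-a.e. }t\in\Omega^\xi_y.$$ -/

import Mathlib

open MeasureTheory Set Filter
open scoped Topology ENNReal

/-- `a` is the approximate limit of `f` at `x` along `S`: for every `ε > 0` the set of the points
of `S` at which `f` is more than `ε` away from `a` has density zero at `x`. -/
def HasApproxLimWithin {X : Type*} [PseudoMetricSpace X] [MeasureSpace X]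
    (f : X → ℝ) (S : Set X) (x : X) (a : ℝ) : Prop :=
  ∀ ε : ℝ, 0 < ε →
    Tendsto (fun r : ℝ =>
        volume {y | y ∈ S ∧ y ∈ Metric.ball x r ∧ ε < |f y - a|} / volume (Metric.ball x r))
      (𝓝[>] 0) (𝓝 0)

/-- The distributional derivative of `v` on the open set `A ⊆ ℝ` is the (real, possibly unbounded)
Radon measure with Jordan decomposition `μp - μn`: both are positive measures concentrated on `A`,
finite on the compact subsets of `A`, mutually singular, and they represent the derivative against
`C¹` test functions with compact support in `A`. -/
structure IsJordanDeriv (v : ℝ → ℝ) (A : Set ℝ) (μp μn : Measure ℝ) : Prop where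
  pos_compl : μp Aᶜ = 0
  neg_compl : μn Aᶜ = 0
  pos_finite : ∀ K : Set ℝ, IsCompact K → K ⊆ A → μp K < ∞
  neg_finite : ∀ K : Set ℝ, IsCompact K → K ⊆ A → μn K < ∞
  mutuallySingular : μp ⟂ₘ μn
  integral_deriv : ∀ φ : ℝ → ℝ, ContDiff ℝ 1 φ → HasCompactSupport φ → tsupport φ ⊆ A →
    ∫ t, v t * deriv φ t = -((∫ t, φ t ∂μp) - ∫ t, φ t ∂μn)

/-- `v ∈ BV_loc(A)`: `v` is locally integrable on `A` and its distributional derivative on `A` is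
a Radon measure. -/
def IsBVLoc (v : ℝ → ℝ) (A : Set ℝ) : Prop :=
  LocallyIntegrableOn v A ∧ ∃ p : Measure ℝ × Measure ℝ, IsJordanDeriv v A p.1 p.2

open Classical in
/-- The (unique) positive and negative parts of the derivative `Dv` of `v ∈ BV_loc(A)`; the value
is not meaningful if `v ∉ BV_loc(A)`. -/
noncomputable def jordanDeriv (v : ℝ → ℝ) (A : Set ℝ) : Measure ℝ × Measure ℝ :=
  if h : IsBVLoc v A then h.2.choose else 0

/-- The total variation measure `|Dv|` of `v ∈ BV_loc(A)`. -/
noncomputable def totalVar (v : ℝ → ℝ) (A : Set ℝ) : Measure ℝ :=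
  (jordanDeriv v A).1 + (jordanDeriv v A).2

/-- `∇v` for `v ∈ BV_loc(A)`: the density of the absolutely continuous part of `Dv` with respect
to Lebesgue measure. -/
noncomputable def bvGrad (v : ℝ → ℝ) (A : Set ℝ) (t : ℝ) : ℝ :=
  ((jordanDeriv v A).1.rnDeriv volume t).toReal - ((jordanDeriv v A).2.rnDeriv volume t).toReal

/-- `J¹_v`: the points of `A` at which the one-sided approximate limits `v⁺`, `v⁻` exist and
differ by more than `1`. -/
def bigJumpSet (v : ℝ → ℝ) (A : Set ℝ) : Set ℝ :=
  {t | t ∈ A ∧ ∃ a b : ℝ, HasApproxLimWithin v (A ∩ Ioi t) t a ∧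
    HasApproxLimWithin v (A ∩ Iio t) t b ∧ 1 < |a - b|}

/-- The one-dimensional section `E^ξ_x = {t ∈ ℝ : x + t ξ ∈ E}`. -/
def sliceSet {n : ℕ} (E : Set (EuclideanSpace ℝ (Fin n))) (ξ x : EuclideanSpace ℝ (Fin n)) :
    Set ℝ :=
  {t | x + t • ξ ∈ E}

/-- The slice `û^ξ_x(t) = u(x + t ξ) · ξ`. -/
noncomputable def sliceFun {n : ℕ} (u : EuclideanSpace ℝ (Fin n) → EuclideanSpace ℝ (Fin n))
    (ξ x : EuclideanSpace ℝ (Fin n)) (t : ℝ) : ℝ :=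
  inner ℝ (u (x + t • ξ)) ξ

/-- `|Dû^ξ_y|(U^ξ_y ∖ J¹) + H⁰(U^ξ_y ∩ J¹)`, where `J¹ = J¹_{û^ξ_y}` and `û^ξ_y` is regarded as
a function on `Ω^ξ_y`. -/
noncomputable def sliceEnergy {n : ℕ} (u : EuclideanSpace ℝ (Fin n) → EuclideanSpace ℝ (Fin n))
    (Ω U : Set (EuclideanSpace ℝ (Fin n))) (ξ y : EuclideanSpace ℝ (Fin n)) : ℝ≥0∞ :=
  totalVar (sliceFun u ξ y) (sliceSet Ω ξ y)
      (sliceSet U ξ y \ bigJumpSet (sliceFun u ξ y) (sliceSet Ω ξ y)) +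
    ((sliceSet U ξ y ∩ bigJumpSet (sliceFun u ξ y) (sliceSet Ω ξ y)).encard : ℝ≥0∞)

/-- `u ∈ GBV^𝓔(Ω; ℝⁿ)`. Only the values of `u` on `Ω` matter. The `(n-1)`-dimensional
Hausdorff measure is `volume.toSphere` (surface measure) on the unit sphere, and `volume` (Lebesgue
measure of the subspace) on the hyperplane `Π^ξ = (ℝ ∙ ξ)ᗮ`. -/
def IsGBVE {n : ℕ} (Ω : Set (EuclideanSpace ℝ (Fin n)))
    (u : EuclideanSpace ℝ (Fin n) → EuclideanSpace ℝ (Fin n)) : Prop :=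
  AEMeasurable u (volume.restrict Ω) ∧
  (∀ᵐ ξ : Metric.sphere (0 : EuclideanSpace ℝ (Fin n)) 1
      ∂(volume : Measure (EuclideanSpace ℝ (Fin n))).toSphere,
    ∀ᵐ y : (Submodule.span ℝ {(ξ : EuclideanSpace ℝ (Fin n))})ᗮ,
      IsBVLoc (sliceFun u ξ y) (sliceSet Ω ξ y)) ∧
  ∃ lam : Measure (EuclideanSpace ℝ (Fin n)), IsFiniteMeasure lam ∧
    ∀ U : Set (EuclideanSpace ℝ (Fin n)), IsOpen U → U ⊆ Ω →
      ∫⁻ ξ : Metric.sphere (0 : EuclideanSpace ℝ (Fin n)) 1,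
        (∫⁻ y : (Submodule.span ℝ {(ξ : EuclideanSpace ℝ (Fin n))})ᗮ, sliceEnergy u Ω U ξ y)
        ∂(volume : Measure (EuclideanSpace ℝ (Fin n))).toSphere ≤ lam U

/-- Du Bois-Reymond: a function on an interval with vanishing distributional derivative is
constant. -/
lemma ae_eq_const_of_integral_mul_deriv_eq_zero {w : ℝ → ℝ} {a b : ℝ} (hab : a < b)
    (hw : IntegrableOn w (Ioo a b))
    (h : ∀ φ : ℝ → ℝ, ContDiff ℝ 1 φ → HasCompactSupport φ → tsupport φ ⊆ Ioo a b →
      ∫ t, w t * deriv φ t = 0) :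
    ∃ c, ∀ᵐ t, t ∈ Ioo a b → w t = c := by
  let m := (a + b) / 2
  let ρ : ContDiffBump m := ⟨(b - a) / 8, (b - a) / 4, by linarith, by linarith⟩
  let r : ℝ → ℝ := ρ.normed volume
  have hrc : Continuous r := (ρ.contDiff_normed (n := 1)).continuous
  have hrs : HasCompactSupport r := ρ.hasCompactSupport_normed
  have hrt : tsupport r ⊆ Ioo a b := by
    have : tsupport r = Metric.closedBall m ((b - a) / 4) := ρ.tsupport_normed_eq
    rw [this, Real.closedBall_eq_Icc]
    intro t ht
    simp only [m, mem_Icc, mem_Ioo] at *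
    constructor <;> linarith
  have hri : ∫ t, r t = 1 := ρ.integral_normed
  have hrI : Integrable r := hrc.integrable_of_hasCompactSupport hrs
  set W : ℝ → ℝ := (Ioo a b).indicator w with hW
  have hWi : Integrable W := hw.integrable_indicator measurableSet_Ioo
  have hmul : ∀ g : ℝ → ℝ, Continuous g → HasCompactSupport g →
      Integrable (fun t => W t * g t) := by
    intro g hg hgs
    obtain ⟨C, hC⟩ := hgs.exists_bound_of_continuous hg
    exact hWi.mul_bdd hg.aestronglyMeasurable (Eventually.of_forall hC)
  refine ⟨∫ t, W t * r t, ?_⟩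
  set c := ∫ t, W t * r t
  have key := isOpen_Ioo.ae_eq_zero_of_integral_contDiff_smul_eq_zero (μ := volume)
    (U := Ioo a b) (f := fun t => w t - c)
    ((hw.sub (by simp)).locallyIntegrableOn) ?_
  · filter_upwards [key] with t ht hm
    linarith [ht hm]
  intro g hg hgs hgt
  have hgc : Continuous g := hg.continuous
  have hgI : Integrable g := hgc.integrable_of_hasCompactSupport hgs
  set I := ∫ t, g t
  let ψ : ℝ → ℝ := fun t => g t - I * r t
  have hψc : Continuous ψ := by fun_prop
  let φ : ℝ → ℝ := fun t => ∫ s in a..t, ψ s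
  have hφd : ∀ t, HasDerivAt φ (ψ t) t := fun t => hψc.integral_hasStrictDerivAt a t |>.hasDerivAt
  have hφ' : deriv φ = ψ := funext fun t => (hφd t).deriv
  have hφ1 : ContDiff ℝ 1 φ := by
    rw [contDiff_one_iff_deriv, hφ']
    exact ⟨fun t => (hφd t).differentiableAt, hψc⟩
  set K := tsupport g ∪ tsupport r
  have hK : IsCompact K := hgs.union hrs
  have hKs : K ⊆ Ioo a b := union_subset hgt hrt
  have hKne : K.Nonempty := by
    refine Set.Nonempty.mono subset_union_right ?_
    rw [show tsupport r = Metric.closedBall m ((b - a) / 4) from ρ.tsupport_normed_eq]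
    exact Metric.nonempty_closedBall.2 (by linarith)
  obtain ⟨a', ha', hal⟩ := hK.exists_isLeast hKne
  obtain ⟨b', hb', hbg⟩ := hK.exists_isGreatest hKne
  have hψ0 : ∀ t, t ∉ Icc a' b' → ψ t = 0 := by
    intro t ht
    have hnK : t ∉ K := fun hk => ht ⟨hal hk, hbg hk⟩
    simp only [K, mem_union, not_or] at hnK
    simp [ψ, image_eq_zero_of_notMem_tsupport hnK.1, image_eq_zero_of_notMem_tsupport hnK.2]
  have hψi : ∫ t, ψ t = 0 := by
    simp only [ψ]
    rw [integral_sub hgI (hrI.const_mul I), integral_const_mul, hri]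
    simp [I]
  have hφ0 : ∀ t, t ∉ Icc a' b' → φ t = 0 := by
    intro t ht
    by_cases h1 : t < a'
    · refine intervalIntegral.integral_zero_ae (Eventually.of_forall fun s hs => hψ0 s fun hs' => ?_)
      have := (hKs ha').1
      rcases le_total a t with h | h
      · rw [uIoc_of_le h] at hs; linarith [hs.2, hs'.1]
      · rw [uIoc_of_ge h] at hs; linarith [hs.2, hs'.1]
    · have h2 : b' < t := by
        by_contra h3; exact ht ⟨not_lt.1 h1, not_lt.1 h3⟩
      have hat : a ≤ t := by linarith [(hKs hb').1]
      simp only [φ]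
      rw [intervalIntegral.integral_of_le hat, ← hψi]
      refine setIntegral_eq_integral_of_forall_compl_eq_zero fun s hs => hψ0 s fun hs' => hs ?_
      exact ⟨by linarith [hs'.1, (hKs ha').1], by linarith [hs'.2]⟩
  have hφt : tsupport φ ⊆ Icc a' b' :=
    closure_minimal (fun t ht => by by_contra hn; exact ht (hφ0 t hn)) isClosed_Icc
  have hφs : HasCompactSupport φ := isCompact_Icc.of_isClosed_subset (isClosed_tsupport _) hφt
  have h0 := h φ hφ1 hφs (hφt.trans fun t ht =>
    ⟨(hKs ha').1.trans_le ht.1, ht.2.trans_lt (hKs hb').2⟩)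
  rw [hφ'] at h0
  have e1 : ∀ t, w t * ψ t = W t * g t - I * (W t * r t) := by
    intro t
    by_cases ht : t ∈ Ioo a b
    · simp only [W, indicator_of_mem ht, ψ]; ring
    · have hnK : t ∉ K := fun hk => ht (hKs hk)
      simp only [K, mem_union, not_or] at hnK
      simp [ψ, image_eq_zero_of_notMem_tsupport hnK.1, image_eq_zero_of_notMem_tsupport hnK.2]
  simp_rw [e1] at h0
  rw [integral_sub (hmul g hgc hgs) ((hmul r hrc hrs).const_mul I), integral_const_mul] at h0
  have e2 : ∀ t, g t • (w t - c) = W t * g t - c * g t := by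
    intro t
    by_cases ht : t ∈ Ioo a b
    · simp only [W, indicator_of_mem ht, smul_eq_mul]; ring
    · simp [image_eq_zero_of_notMem_tsupport fun hk => ht (hgt hk)]
  simp_rw [e2]
  rw [integral_sub (hmul g hgc hgs) (hgI.const_mul c), integral_const_mul]
  change _ - c * I = 0
  change _ - I * c = 0 at h0
  linarith

/-- Integration by parts against the distribution function of a finite measure. -/
lemma integral_real_Iic_mul_deriv (ν : Measure ℝ) [IsFiniteMeasure ν] {φ : ℝ → ℝ}
    (hφ : ContDiff ℝ 1 φ) (hs : HasCompactSupport φ) :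
    ∫ t, ν.real (Iic t) * deriv φ t = -∫ t, φ t ∂ν := by
  have hd : Continuous (deriv φ) := hφ.continuous_deriv le_rfl
  have hdI : Integrable (deriv φ) := hd.integrable_of_hasCompactSupport hs.deriv
  have hset : MeasurableSet {p : ℝ × ℝ | p.1 ≤ p.2} := measurableSet_le measurable_fst measurable_snd
  have hint : Integrable (Function.uncurry fun s t : ℝ => (Ici s).indicator (deriv φ) t)
      (ν.prod volume) := by
    have := (hdI.comp_snd ν).indicator hset
    refine this.congr (Eventually.of_forall fun p => ?_)
    simp [indicator, Function.uncurry]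
  have hsw := integral_integral_swap hint
  have h1 : ∀ s : ℝ, ∫ t, (Ici s).indicator (deriv φ) t = - φ s := by
    intro s
    rw [integral_indicator measurableSet_Ici, integral_Ici_eq_integral_Ioi,
      hs.integral_Ioi_deriv_eq hφ]
  have h2 : ∀ t : ℝ, ∫ s, (Ici s).indicator (deriv φ) t ∂ν = ν.real (Iic t) * deriv φ t := by
    intro t
    have : (fun s : ℝ => (Ici s).indicator (deriv φ) t) = (Iic t).indicator fun _ => deriv φ t := by
      ext s; simp [indicator]
    rw [this, integral_indicator measurableSet_Iic, setIntegral_const, smul_eq_mul]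
  simp_rw [h1, h2] at hsw
  rw [← hsw, integral_neg]

lemma ae_hasDerivAt_real_Iic (ν : Measure ℝ) [IsFiniteMeasure ν] :
    ∀ᵐ x, HasDerivAt (fun t => ν.real (Iic t)) (ν.rnDeriv volume x).toReal x := by
  have hmono : Monotone fun t => ν.real (Iic t) := fun s t h => measureReal_mono (Iic_subset_Iic.2 h)
  let f : StieltjesFunction ℝ :=
    { toFun := fun t => ν.real (Iic t)
      mono' := hmono
      right_continuous' := by
        intro x
        have : Tendsto (fun t => ν (Iic t)) (𝓝[>] x) (𝓝 (ν (⋂ t > x, Iic t))) := by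
          refine tendsto_measure_biInter_gt (fun t _ => measurableSet_Iic.nullMeasurableSet)
            (fun i j _ hij => Iic_subset_Iic.2 hij) ⟨x + 1, by simp, measure_ne_top _ _⟩
        have e : (⋂ t > x, Iic t) = Iic x := by
          ext y; simp only [mem_iInter, mem_Iic]
          exact ⟨fun h => le_of_forall_gt_imp_ge_of_dense h, fun h t ht => h.trans ht.le⟩
        rw [e] at this
        have h2 := (ENNReal.tendsto_toReal (measure_ne_top ν (Iic x))).comp this
        exact continuousWithinAt_Ioi_iff_Ici.1 h2 }
  have hb : Tendsto f atBot (𝓝 0) := by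
    have : Tendsto (fun t => ν (Iic t)) atBot (𝓝 (ν (⋂ t, Iic t))) :=
      tendsto_measure_iInter_atBot (fun t => measurableSet_Iic.nullMeasurableSet)
        (fun s t h => Iic_subset_Iic.2 h) ⟨0, measure_ne_top _ _⟩
    rw [iInter_Iic_eq_empty_iff.2 (by simp), measure_empty] at this
    have h2 := (ENNReal.tendsto_toReal ENNReal.zero_ne_top).comp this
    rwa [ENNReal.toReal_zero] at h2
  have ht : Tendsto f atTop (𝓝 (ν.real univ)) :=
    (ENNReal.tendsto_toReal (measure_ne_top _ _)).comp (tendsto_measure_Iic_atTop ν)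
  have : IsFiniteMeasure f.measure := f.isFiniteMeasure hb ht
  have hm : f.measure = ν := by
    refine Measure.ext_of_Iic _ _ fun a => ?_
    rw [f.measure_Iic hb, sub_zero]
    exact ENNReal.ofReal_toReal (measure_ne_top _ _)
  have := f.ae_hasDerivAt
  rw [hm] at this
  exact this

lemma exists_rat_Icc_subset {A : Set ℝ} (hA : IsOpen A) {t : ℝ} (ht : t ∈ A) :
    ∃ p : ℚ × ℚ, t ∈ Ioo (p.1 : ℝ) p.2 ∧ Icc (p.1 : ℝ) p.2 ⊆ A := by
  obtain ⟨ε, hε, hb⟩ := Metric.isOpen_iff.1 hA t ht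
  obtain ⟨p, hp1, hp2⟩ := exists_rat_btwn (show t - ε < t by linarith)
  obtain ⟨q, hq1, hq2⟩ := exists_rat_btwn (show t < t + ε by linarith)
  refine ⟨(p, q), ⟨hp2, hq1⟩, fun s hs => hb ?_⟩
  rw [Real.ball_eq_Ioo]
  exact ⟨hp1.trans_le hs.1, hs.2.trans_lt hq2⟩

lemma sigmaFinite_of_compact_subset {μ : Measure ℝ} {A : Set ℝ} (hA : IsOpen A) (h0 : μ Aᶜ = 0)
    (hK : ∀ K : Set ℝ, IsCompact K → K ⊆ A → μ K < ∞) : SigmaFinite μ := by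
  refine Measure.sigmaFinite_of_countable
    (S := insert Aᶜ ((fun p : ℚ × ℚ => Icc (p.1 : ℝ) p.2) '' {p | Icc (p.1 : ℝ) p.2 ⊆ A}))
    ((countable_range _ |>.mono (image_subset_range _ _)).insert _) ?_ ?_
  · rintro s (rfl | ⟨p, hp, rfl⟩)
    · simp [h0]
    · exact hK _ isCompact_Icc hp
  · refine eq_univ_of_forall fun t => ?_
    by_cases ht : t ∈ A
    · obtain ⟨p, hp, hs⟩ := exists_rat_Icc_subset hA ht
      exact ⟨_, Or.inr ⟨p, hs, rfl⟩, Ioo_subset_Icc_self hp⟩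
    · exact ⟨_, Or.inl rfl, ht⟩

lemma IsBVLoc.isJordanDeriv {v : ℝ → ℝ} {A : Set ℝ} (hv : IsBVLoc v A) :
    IsJordanDeriv v A (jordanDeriv v A).1 (jordanDeriv v A).2 := by
  rw [jordanDeriv, dif_pos hv]
  exact hv.2.choose_spec

lemma IsJordanDeriv.exists_hasDerivAt {v : ℝ → ℝ} {A : Set ℝ} {μp μn : Measure ℝ} (hA : IsOpen A)
    (hv : LocallyIntegrableOn v A) (h : IsJordanDeriv v A μp μn) {a b : ℝ} (hab : a < b)
    (hs : Icc a b ⊆ A) :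
    ∃ F : ℝ → ℝ, (∀ᵐ t, t ∈ Ioo a b →
        HasDerivAt F ((μp.rnDeriv volume t).toReal - (μn.rnDeriv volume t).toReal) t) ∧
      ∀ᵐ t, t ∈ Ioo a b → v t = F t := by
  have := sigmaFinite_of_compact_subset hA h.pos_compl h.pos_finite
  have := sigmaFinite_of_compact_subset hA h.neg_compl h.neg_finite
  set νp := μp.restrict (Ioo a b) with hνp
  set νn := μn.restrict (Ioo a b) with hνn
  have : IsFiniteMeasure νp := ⟨by
    rw [hνp, Measure.restrict_apply_univ]
    exact (measure_mono Ioo_subset_Icc_self).trans_lt (h.pos_finite _ isCompact_Icc hs)⟩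
  have : IsFiniteMeasure νn := ⟨by
    rw [hνn, Measure.restrict_apply_univ]
    exact (measure_mono Ioo_subset_Icc_self).trans_lt (h.neg_finite _ isCompact_Icc hs)⟩
  have hvI : IntegrableOn v (Ioo a b) :=
    (hv.integrableOn_compact_subset hs isCompact_Icc).mono_set Ioo_subset_Icc_self
  have hmeas : ∀ ν : Measure ℝ, IsFiniteMeasure ν → Measurable fun t => ν.real (Iic t) :=
    fun ν _ => Monotone.measurable fun s t hst => measureReal_mono (Iic_subset_Iic.2 hst)
  have hbd : ∀ ν : Measure ℝ, IsFiniteMeasure ν → ∀ t, ‖ν.real (Iic t)‖ ≤ ν.real univ :=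
    fun ν _ t => by
      rw [Real.norm_of_nonneg measureReal_nonneg]; exact measureReal_mono (subset_univ _)
  have hFI : ∀ ν : Measure ℝ, IsFiniteMeasure ν →
      IntegrableOn (fun t => ν.real (Iic t)) (Ioo a b) := fun ν hν =>
    Integrable.of_bound (hmeas ν hν).aestronglyMeasurable (ν.real univ)
      (Eventually.of_forall (hbd ν hν))
  obtain ⟨c, hc⟩ := ae_eq_const_of_integral_mul_deriv_eq_zero
    (w := fun t => v t - (νp.real (Iic t) - νn.real (Iic t))) hab
    (hvI.sub ((hFI νp ‹_›).sub (hFI νn ‹_›))) (by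
      intro φ hφ hφs hφt
      have hd : Continuous (deriv φ) := hφ.continuous_deriv le_rfl
      have hdI : Integrable (deriv φ) := hd.integrable_of_hasCompactSupport hφs.deriv
      have hFd : ∀ ν : Measure ℝ, IsFiniteMeasure ν →
          Integrable fun t => ν.real (Iic t) * deriv φ t := fun ν hν =>
        hdI.bdd_mul (hmeas ν hν).aestronglyMeasurable (Eventually.of_forall (hbd ν hν))
      have hd0 : ∀ t, t ∉ Ioo a b → deriv φ t = 0 := fun t ht =>
        image_eq_zero_of_notMem_tsupport fun hk => ht (hφt (tsupport_deriv_subset hk))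
      have hvd : Integrable fun t => v t * deriv φ t := by
        obtain ⟨C, hC⟩ := hφs.deriv.exists_bound_of_continuous hd
        have := (hvI.integrable_indicator measurableSet_Ioo).mul_bdd (c := C)
          hd.aestronglyMeasurable (Eventually.of_forall hC)
        refine this.congr (Eventually.of_forall fun t => ?_)
        by_cases ht : t ∈ Ioo a b
        · simp [indicator_of_mem ht]
        · simp [hd0 t ht]
      have hr : ∀ μ : Measure ℝ, ∫ t, φ t ∂(μ.restrict (Ioo a b)) = ∫ t, φ t ∂μ := fun μ =>
        setIntegral_eq_integral_of_forall_compl_eq_zero fun t ht =>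
          image_eq_zero_of_notMem_tsupport fun hk => ht (hφt hk)
      have e : ∀ t, (v t - (νp.real (Iic t) - νn.real (Iic t))) * deriv φ t =
          v t * deriv φ t - (νp.real (Iic t) * deriv φ t - νn.real (Iic t) * deriv φ t) :=
        fun t => by ring
      simp_rw [e]
      have hsub : Integrable fun t =>
          νp.real (Iic t) * deriv φ t - νn.real (Iic t) * deriv φ t :=
        (hFd νp ‹_›).sub (hFd νn ‹_›)
      rw [integral_sub hvd hsub, integral_sub (hFd νp ‹_›) (hFd νn ‹_›),
        integral_real_Iic_mul_deriv νp hφ hφs, integral_real_Iic_mul_deriv νn hφ hφs,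
        h.integral_deriv φ hφ hφs (hφt.trans (Ioo_subset_Icc_self.trans hs)), hνp, hνn, hr, hr]
      ring)
  refine ⟨fun t => νp.real (Iic t) - νn.real (Iic t) + c, ?_, ?_⟩
  · filter_upwards [ae_hasDerivAt_real_Iic νp, ae_hasDerivAt_real_Iic νn,
      Measure.rnDeriv_restrict μp volume (measurableSet_Ioo (a := a) (b := b)),
      Measure.rnDeriv_restrict μn volume (measurableSet_Ioo (a := a) (b := b))] with t h1 h2 h3 h4 ht
    rw [h3, indicator_of_mem ht] at h1
    rw [h4, indicator_of_mem ht] at h2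
    exact (h1.sub h2).add_const c
  · filter_upwards [hc] with t h1 ht
    linarith [h1 ht]

/-- Near almost every point of `A`, a function in `BV_loc(A)` agrees almost everywhere with a
function that is differentiable at that point. -/
lemma IsBVLoc.ae_exists_hasDerivAt {v v' : ℝ → ℝ} {A : Set ℝ} (hA : IsOpen A) (hv : IsBVLoc v A)
    (hv' : ∀ᵐ t, t ∈ A → v' t = v t) (h : ℕ → ℝ) :
    ∀ᵐ t, t ∈ A → ∃ a b, t ∈ Ioo a b ∧ ∃ F : ℝ → ℝ, HasDerivAt F (bvGrad v A t) t ∧ v' t = F t ∧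
      (∀ᵐ s, s ∈ Ioo a b → v' s = F s) ∧
      ∀ k, t + h k ∈ Ioo a b → v' (t + h k) = F (t + h k) := by
  have key : ∀ p : ℚ × ℚ, Icc (p.1 : ℝ) p.2 ⊆ A → ∃ F : ℝ → ℝ,
      (∀ᵐ t, t ∈ Ioo (p.1 : ℝ) p.2 → HasDerivAt F (bvGrad v A t) t) ∧
      ∀ᵐ t, t ∈ Ioo (p.1 : ℝ) p.2 → v' t = F t := by
    intro p hp
    rcases lt_or_ge (p.1 : ℝ) p.2 with hlt | hge
    · obtain ⟨F, h1, h2⟩ := hv.isJordanDeriv.exists_hasDerivAt hA hv.1 hlt hp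
      refine ⟨F, h1, ?_⟩
      filter_upwards [h2, hv'] with t h3 h4 ht
      rw [h4 (hp (Ioo_subset_Icc_self ht)), h3 ht]
    · exact ⟨0, by simp [Ioo_eq_empty (not_lt.2 hge)], by simp [Ioo_eq_empty (not_lt.2 hge)]⟩
  choose! F hF1 hF2 using key
  have all : ∀ᵐ t, ∀ p : ℚ × ℚ, Icc (p.1 : ℝ) p.2 ⊆ A → t ∈ Ioo (p.1 : ℝ) p.2 →
      HasDerivAt (F p) (bvGrad v A t) t ∧ v' t = F p t ∧
      ∀ k, t + h k ∈ Ioo (p.1 : ℝ) p.2 → v' (t + h k) = F p (t + h k) := by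
    rw [ae_all_iff]
    intro p
    by_cases hp : Icc (p.1 : ℝ) p.2 ⊆ A
    · have h3 : ∀ᵐ t, ∀ k, t + h k ∈ Ioo (p.1 : ℝ) p.2 → v' (t + h k) = F p (t + h k) :=
        ae_all_iff.2 fun k =>
          (measurePreserving_add_right volume (h k)).quasiMeasurePreserving.ae (hF2 p hp)
      filter_upwards [hF1 p hp, hF2 p hp, h3] with t h1 h2 h3 _ ht
      exact ⟨h1 ht, h2 ht, h3⟩
    · exact Eventually.of_forall fun t hp' => absurd hp' hp
  filter_upwards [all] with t ht htA
  obtain ⟨p, hp, hs⟩ := exists_rat_Icc_subset hA htA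
  obtain ⟨h1, h2, h3⟩ := ht p hs hp
  exact ⟨p.1, p.2, hp, F p, h1, h2, hF2 p hs, h3⟩

lemma IsBVLoc.ae_tendsto_slope {v v' : ℝ → ℝ} {A : Set ℝ} (hA : IsOpen A) (hv : IsBVLoc v A)
    (hv' : ∀ᵐ t, t ∈ A → v' t = v t) {h : ℕ → ℝ} (h0 : ∀ k, h k ≠ 0)
    (ht : Tendsto h atTop (𝓝 0)) :
    ∀ᵐ t, t ∈ A → Tendsto (fun k => (v' (t + h k) - v' t) / h k) atTop (𝓝 (bvGrad v A t)) := by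
  filter_upwards [hv.ae_exists_hasDerivAt hA hv' h] with t h1 htA
  obtain ⟨a, b, hab, F, hF, h2, -, h3⟩ := h1 htA
  have hne : Tendsto h atTop (𝓝[≠] 0) :=
    tendsto_nhdsWithin_iff.2 ⟨ht, Eventually.of_forall h0⟩
  have hlim := (hasDerivAt_iff_tendsto_slope_zero.1 hF).comp hne
  have hev : ∀ᶠ k in atTop, t + h k ∈ Ioo a b := by
    have : Tendsto (fun k => t + h k) atTop (𝓝 t) := by simpa using ht.const_add t
    exact this (Ioo_mem_nhds hab.1 hab.2)
  refine hlim.congr' ?_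
  filter_upwards [hev] with k hk
  simp [h3 k hk, h2, div_eq_inv_mul]

lemma IsBVLoc.ae_essential_deriv {v v' : ℝ → ℝ} {A : Set ℝ} (hA : IsOpen A) (hv : IsBVLoc v A)
    (hv' : ∀ᵐ t, t ∈ A → v' t = v t) :
    ∀ᵐ t, t ∈ A → ∀ ε > 0, ∃ δ > 0, ∀ᵐ s, |s| < δ →
      |v' (t + s) - v' t - s * bvGrad v A t| ≤ ε * |s| := by
  filter_upwards [hv.ae_exists_hasDerivAt hA hv' 0] with t h1 htA ε hε
  obtain ⟨a, b, hab, F, hF, h2, h3, -⟩ := h1 htA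
  have h4 := (hasDerivAt_iff_isLittleO_nhds_zero.1 hF).def hε
  have h5 : ∀ᶠ s in 𝓝 (0 : ℝ), t + s ∈ Ioo a b := by
    have : Tendsto (fun s => t + s) (𝓝 0) (𝓝 (t + 0)) := (continuous_const_add t).tendsto 0
    rw [add_zero] at this
    exact this (Ioo_mem_nhds hab.1 hab.2)
  obtain ⟨δ, hδ, hb⟩ := Metric.eventually_nhds_iff.1 (h4.and h5)
  refine ⟨δ, hδ, ?_⟩
  filter_upwards [(measurePreserving_add_left volume t).quasiMeasurePreserving.ae h3] with s hs hsδ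
  obtain ⟨h6, h7⟩ := hb (y := s) (by simpa using hsδ)
  rw [hs h7, h2]
  simpa using h6

lemma HasApproxLimWithin.eq_of_ae {v : ℝ → ℝ} {S : Set ℝ} {t a c : ℝ}
    (ha : HasApproxLimWithin v S t a)
    (hS : ∀ᶠ r in 𝓝[>] (0 : ℝ), ENNReal.ofReal r ≤ volume (S ∩ Metric.ball t r))
    (hc : ∀ ε > 0, ∃ δ > 0, ∀ᵐ s, |s| < δ → |v (t + s) - c| ≤ ε) : a = c := by
  by_contra hne
  set ε := |a - c| / 3 with hε
  have hpos : 0 < |a - c| := abs_pos.2 (sub_ne_zero.2 hne)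
  obtain ⟨δ, hδ, hae⟩ := hc ε (by positivity)
  have hae' : ∀ᵐ y, |y - t| < δ → |v y - c| ≤ ε := by
    have := (measurePreserving_add_left volume (-t)).quasiMeasurePreserving.ae hae
    filter_upwards [this] with y hy hyt
    have e : t + (-t + y) = y := by ring
    rw [e] at hy
    exact hy (by rwa [neg_add_eq_sub])
  have hlt : ∀ᶠ r in 𝓝[>] (0 : ℝ),
      volume {y | y ∈ S ∧ y ∈ Metric.ball t r ∧ ε < |v y - a|} / volume (Metric.ball t r) < 1 / 2 :=
    (ha ε (by positivity)).eventually (gt_mem_nhds (by simp))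
  have hsm : ∀ᶠ r in 𝓝[>] (0 : ℝ), r ∈ Ioo 0 δ := Ioo_mem_nhdsGT hδ
  obtain ⟨r, h1, h2, hr0, hrδ⟩ := (hlt.and (hS.and hsm)).exists
  have h3 : volume (S ∩ Metric.ball t r) ≤
      volume {y | y ∈ S ∧ y ∈ Metric.ball t r ∧ ε < |v y - a|} := by
    refine measure_mono_ae ?_
    filter_upwards [hae'] with y hy hyS
    refine ⟨hyS.1, hyS.2, ?_⟩
    have h4 := hy ((Real.dist_eq y t ▸ Metric.mem_ball.1 hyS.2).trans hrδ)
    have h5 : |a - c| ≤ |v y - a| + |v y - c| := by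
      rw [abs_sub_comm (v y) a]; exact abs_sub_le a (v y) c
    linarith
  rw [Real.volume_ball, ENNReal.div_lt_iff (Or.inl (by simp [hr0])) (Or.inl ENNReal.ofReal_ne_top)] at h1
  have h6 := (h2.trans h3).trans_lt h1
  rw [ENNReal.ofReal_mul (by norm_num), ← mul_assoc] at h6
  simp [ENNReal.inv_mul_cancel] at h6

lemma IsBVLoc.ae_notMem_bigJumpSet {v : ℝ → ℝ} {A : Set ℝ} (hA : IsOpen A) (hv : IsBVLoc v A) :
    ∀ᵐ t, t ∉ bigJumpSet v A := by
  filter_upwards [hv.ae_essential_deriv hA (v' := v) (Eventually.of_forall fun _ _ => rfl)]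
    with t ht hJ
  obtain ⟨htA, a, b, ha, hb, hab⟩ := hJ
  have hc : ∀ ε > 0, ∃ δ > 0, ∀ᵐ s, |s| < δ → |v (t + s) - v t| ≤ ε := by
    intro ε hε
    obtain ⟨δ, hδ, h1⟩ := ht htA 1 one_pos
    set g := bvGrad v A t
    refine ⟨min δ (ε / (1 + |g|)), by positivity, ?_⟩
    filter_upwards [h1] with s hs hsδ
    have h2 := hs (hsδ.trans_le (min_le_left _ _))
    have h3 := (lt_div_iff₀ (by positivity)).1 (hsδ.trans_le (min_le_right _ _))
    calc |v (t + s) - v t| = |(v (t + s) - v t - s * g) + s * g| := by ring_nf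
      _ ≤ |v (t + s) - v t - s * g| + |s * g| := abs_add_le _ _
      _ ≤ 1 * |s| + |s| * |g| := by rw [abs_mul]; gcongr
      _ ≤ ε := by linarith
  obtain ⟨δ, hδ, hball⟩ := Metric.isOpen_iff.1 hA t htA
  have hsm : ∀ᶠ r in 𝓝[>] (0 : ℝ), r ∈ Ioo 0 δ := Ioo_mem_nhdsGT hδ
  have h1 : a = v t := ha.eq_of_ae (by
    filter_upwards [hsm] with r hr
    refine le_trans (by simp) (measure_mono (μ := volume) (s := Ioo t (t + r)) fun y hy => ?_)
    have : y ∈ Metric.ball t r := by rw [Real.ball_eq_Ioo]; exact ⟨by linarith [hy.1, hr.1], hy.2⟩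
    exact ⟨⟨hball (Metric.ball_subset_ball hr.2.le this), hy.1⟩, this⟩) hc
  have h2 : b = v t := hb.eq_of_ae (by
    filter_upwards [hsm] with r hr
    refine le_trans (by simp) (measure_mono (μ := volume) (s := Ioo (t - r) t) fun y hy => ?_)
    have : y ∈ Metric.ball t r := by rw [Real.ball_eq_Ioo]; exact ⟨hy.1, by linarith [hy.2, hr.1]⟩
    exact ⟨⟨hball (Metric.ball_subset_ball hr.2.le this), hy.2⟩, this⟩) hc
  rw [h1, h2] at hab
  norm_num at hab

lemma IsBVLoc.lintegral_bvGrad_le {v : ℝ → ℝ} {A : Set ℝ} (hA : IsOpen A) (hv : IsBVLoc v A) :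
    ∫⁻ t in A, ‖bvGrad v A t‖ₑ ≤ totalVar v A (A \ bigJumpSet v A) := by
  have h0 : (A \ bigJumpSet v A : Set ℝ) =ᵐ[volume] A := by
    filter_upwards [hv.ae_notMem_bigJumpSet hA] with t ht
    exact propext ⟨fun h => h.1, fun h => ⟨h, ht⟩⟩
  rw [← Measure.restrict_congr_set h0, totalVar, Measure.add_apply]
  calc ∫⁻ t in A \ bigJumpSet v A, ‖bvGrad v A t‖ₑ
      ≤ ∫⁻ t in A \ bigJumpSet v A, ((jordanDeriv v A).1.rnDeriv volume t +
          (jordanDeriv v A).2.rnDeriv volume t) := by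
        refine lintegral_mono fun t => ?_
        refine (enorm_sub_le (a := ((jordanDeriv v A).1.rnDeriv volume t).toReal)).trans ?_
        gcongr <;>
        · rw [Real.enorm_of_nonneg ENNReal.toReal_nonneg]; exact ENNReal.ofReal_toReal_le
    _ ≤ _ := by
        rw [lintegral_add_left (Measure.measurable_rnDeriv _ _)]
        gcongr <;> exact Measure.setLIntegral_rnDeriv_le _

lemma IsBVLoc.comp_mul_left {v : ℝ → ℝ} {A : Set ℝ} (hA : IsOpen A) (hv : IsBVLoc v A) {r : ℝ}
    (hr : 0 < r) : IsBVLoc (fun t => r * v (r * t)) {t | r * t ∈ A} := by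
  have hA' : IsOpen {t | r * t ∈ A} := hA.preimage (continuous_const_mul r)
  obtain ⟨hI, ⟨μp, μn⟩, h⟩ := hv
  have hm : Measurable fun s : ℝ => r⁻¹ * s := by fun_prop
  have hfin : ∀ μ : Measure ℝ, (∀ K : Set ℝ, IsCompact K → K ⊆ A → μ K < ∞) →
      ∀ K : Set ℝ, IsCompact K → K ⊆ {t | r * t ∈ A} →
        (ENNReal.ofReal r • μ.map fun s => r⁻¹ * s) K < ∞ := by
    intro μ hμ K hK hs
    rw [Measure.smul_apply, Measure.map_apply hm hK.measurableSet, smul_eq_mul]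
    refine ENNReal.mul_lt_top (by simp) ?_
    have e : (fun s => r⁻¹ * s) ⁻¹' K = (fun s => r * s) '' K := by
      ext s; simp only [mem_preimage, mem_image]
      exact ⟨fun h => ⟨_, h, by field_simp⟩, by rintro ⟨x, hx, rfl⟩; field_simp; exact hx⟩
    rw [e]
    exact hμ _ (hK.image (continuous_const_mul r)) (by rintro _ ⟨x, hx, rfl⟩; exact hs hx)
  have hcompl : ∀ μ : Measure ℝ, μ Aᶜ = 0 →
      (ENNReal.ofReal r • μ.map fun s => r⁻¹ * s) {t | r * t ∈ A}ᶜ = 0 := by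
    intro μ hμ
    rw [Measure.smul_apply, Measure.map_apply hm hA'.measurableSet.compl]
    have e : (fun s => r⁻¹ * s) ⁻¹' {t | r * t ∈ A}ᶜ = Aᶜ := by
      ext s; simp [mul_inv_cancel_left₀ hr.ne']
    rw [e, hμ, smul_zero]
  refine ⟨?_, (ENNReal.ofReal r • μp.map fun s => r⁻¹ * s,
    ENNReal.ofReal r • μn.map fun s => r⁻¹ * s), ⟨hcompl _ h.pos_compl, hcompl _ h.neg_compl,
    hfin _ h.pos_finite, hfin _ h.neg_finite, ?_, ?_⟩⟩
  · rw [locallyIntegrableOn_iff hA'.isLocallyClosed]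
    intro K hs hK
    have hI' := hI.integrableOn_compact_subset (t := (fun s => r * s) '' K)
      (by rintro _ ⟨x, hx, rfl⟩; exact hs hx) (hK.image (continuous_const_mul r))
    rw [← integrable_indicator_iff (hK.image (continuous_const_mul r)).measurableSet,
      ← integrable_comp_mul_left_iff _ hr.ne'] at hI'
    rw [← integrable_indicator_iff hK.measurableSet]
    refine (hI'.const_mul r).congr (Eventually.of_forall fun t => ?_)
    have e : r * t ∈ (fun s => r * s) '' K ↔ t ∈ K := by simp [hr.ne']
    by_cases ht : t ∈ K
    · simp only [indicator_of_mem ht, indicator_of_mem (e.2 ht)]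
    · simp only [indicator_of_notMem ht, indicator_of_notMem (mt e.1 ht), mul_zero]
  · obtain ⟨S, hS, h1, h2⟩ := h.mutuallySingular
    refine ⟨(fun s => r * s) ⁻¹' S, hS.preimage (by fun_prop), ?_, ?_⟩
    · rw [Measure.smul_apply, Measure.map_apply hm (hS.preimage (by fun_prop))]
      have e : (fun s => r⁻¹ * s) ⁻¹' ((fun s => r * s) ⁻¹' S) = S := by
        ext s; simp [mul_inv_cancel_left₀ hr.ne']
      rw [e, h1, smul_zero]
    · rw [Measure.smul_apply, Measure.map_apply hm (hS.preimage (by fun_prop)).compl]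
      have e : (fun s => r⁻¹ * s) ⁻¹' ((fun s => r * s) ⁻¹' S)ᶜ = Sᶜ := by
        ext s; simp [mul_inv_cancel_left₀ hr.ne']
      rw [e, h2, smul_zero]
  · intro φ hφ hφs hφt
    set ψ : ℝ → ℝ := fun s => φ (r⁻¹ * s) with hψ
    have hψ' : ∀ s, deriv ψ s = r⁻¹ * deriv φ (r⁻¹ * s) := fun s => by
      rw [hψ, deriv_comp_mul_left, smul_eq_mul]
    let e : ℝ ≃ₜ ℝ := Homeomorph.mulLeft₀ r⁻¹ (inv_ne_zero hr.ne')
    have hψs : HasCompactSupport ψ := hφs.comp_homeomorph e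
    have hψt : tsupport ψ ⊆ A := by
      have h1 : tsupport ψ ⊆ e ⁻¹' tsupport φ := tsupport_comp_subset_preimage φ e.continuous
      intro s hs
      have := hφt (h1 hs)
      change r * (r⁻¹ * s) ∈ A at this
      rwa [mul_inv_cancel_left₀ hr.ne'] at this
    have h1 := h.integral_deriv ψ (hφ.comp (contDiff_const.mul contDiff_id)) hψs hψt
    have h2 : ∀ t, r * v (r * t) * deriv φ t = (fun s => r ^ 2 * (v s * deriv ψ s)) (r * t) := by
      intro t
      simp only [hψ']
      rw [inv_mul_cancel_left₀ hr.ne']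
      field_simp
    have h3 : ∀ μ : Measure ℝ, ∫ t, φ t ∂(ENNReal.ofReal r • μ.map fun s => r⁻¹ * s) =
        r * ∫ t, ψ t ∂μ := by
      intro μ
      rw [integral_smul_measure, ENNReal.toReal_ofReal hr.le, smul_eq_mul,
        integral_map hm.aemeasurable hφ.continuous.aestronglyMeasurable]
    rw [integral_congr_ae (Eventually.of_forall h2),
      Measure.integral_comp_mul_left (fun s => r ^ 2 * (v s * deriv ψ s)) r, integral_const_mul, h1, h3, h3,
      abs_of_pos (inv_pos.2 hr), smul_eq_mul]
    field_simp

lemma ae_comp_mul_left {P : ℝ → Prop} {c : ℝ} (hc : c ≠ 0) (h : ∀ᵐ t, P t) :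
    ∀ᵐ t, P (c * t) := by
  have : Measure.QuasiMeasurePreserving (fun t : ℝ => c * t) volume volume :=
    ⟨by fun_prop, by rw [Real.map_volume_mul_left hc]; exact Measure.smul_absolutelyContinuous⟩
  exact this.ae h

section Geometry

variable {E : Type*} [NormedAddCommGroup E] [InnerProductSpace ℝ E] [FiniteDimensional ℝ E]
  [MeasurableSpace E] [BorelSpace E]

lemma measurePreserving_add_smul {θ : E} (hθ : ‖θ‖ = 1) {K : Submodule ℝ E}
    (hK : K = Submodule.span ℝ {θ}) :
    MeasurePreserving (fun p : Kᗮ × ℝ => (p.1 : E) + p.2 • θ) (volume.prod volume) volume := by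
  subst hK
  set K := Submodule.span ℝ {θ}
  have h1 : MeasurePreserving (LinearIsometryEquiv.toSpanUnitSingleton θ hθ : ℝ → K)
      volume volume := LinearIsometryEquiv.measurePreserving _
  have h2 : MeasurePreserving (Prod.map (LinearIsometryEquiv.toSpanUnitSingleton θ hθ : ℝ → K)
      (id : Kᗮ → Kᗮ)) (volume.prod volume) (volume.prod volume) :=
    h1.prod (MeasurePreserving.id volume)
  have h3 := (K.orthogonalDecomposition.symm.measurePreserving).comp
    ((WithLp.volume_preserving_toLp K Kᗮ).comp
      (h2.comp (Measure.measurePreserving_swap (μ := (volume : Measure Kᗮ)) (ν := volume))))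
  have e : (fun p : Kᗮ × ℝ => (p.1 : E) + p.2 • θ) = K.orthogonalDecomposition.symm ∘
      WithLp.toLp 2 ∘ Prod.map (LinearIsometryEquiv.toSpanUnitSingleton θ hθ : ℝ → K) id ∘
      Prod.swap := by
    ext p
    simp [add_comm]
  rw [e]
  exact h3

lemma ae_slice_of_ae {ζ : E} (hζ : ζ ≠ 0) {P : E → Prop} (h : ∀ᵐ x, P x) :
    ∀ᵐ y : (Submodule.span ℝ {ζ})ᗮ, ∀ᵐ t : ℝ, P (y + t • ζ) := by
  have hθ : ‖(‖ζ‖⁻¹ • ζ)‖ = 1 := norm_smul_inv_norm hζ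
  have hK : Submodule.span ℝ {ζ} = Submodule.span ℝ {‖ζ‖⁻¹ • ζ} :=
    (Submodule.span_singleton_smul_eq (IsUnit.mk0 _ (inv_ne_zero (norm_ne_zero_iff.2 hζ))) ζ).symm
  have h1 := Measure.ae_ae_of_ae_prod
    ((measurePreserving_add_smul hθ hK).quasiMeasurePreserving.ae h)
  filter_upwards [h1] with y hy
  filter_upwards [ae_comp_mul_left (norm_ne_zero_iff.2 hζ) hy] with t ht
  rwa [smul_smul, mul_right_comm, mul_inv_cancel₀ (norm_ne_zero_iff.2 hζ), one_mul] at ht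

lemma ae_of_ae_slice {ζ : E} (hζ : ζ ≠ 0) {P : E → Prop} (hP : MeasurableSet {x | P x})
    (h : ∀ᵐ y : (Submodule.span ℝ {ζ})ᗮ, ∀ᵐ t : ℝ, P (y + t • ζ)) : ∀ᵐ x, P x := by
  have hθ : ‖(‖ζ‖⁻¹ • ζ)‖ = 1 := norm_smul_inv_norm hζ
  have hK : Submodule.span ℝ {ζ} = Submodule.span ℝ {‖ζ‖⁻¹ • ζ} :=
    (Submodule.span_singleton_smul_eq (IsUnit.mk0 _ (inv_ne_zero (norm_ne_zero_iff.2 hζ))) ζ).symm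
  have mp := measurePreserving_add_smul hθ hK
  rw [← mp.map_eq, ae_map_iff mp.measurable.aemeasurable hP]
  refine (Measure.ae_prod_iff_ae_ae (mp.measurable hP)).2 ?_
  filter_upwards [h] with y hy
  filter_upwards [ae_comp_mul_left (inv_ne_zero (norm_ne_zero_iff.2 hζ)) hy] with t ht
  rwa [mul_comm, mul_smul] at ht

lemma lintegral_slice {θ : E} (hθ : ‖θ‖ = 1) {f : E → ℝ≥0∞} (hf : Measurable f) :
    ∫⁻ x, f x = ∫⁻ y : (Submodule.span ℝ {θ})ᗮ, ∫⁻ t : ℝ, f (y + t • θ) := by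
  have mp := measurePreserving_add_smul hθ rfl
  rw [← mp.lintegral_comp hf]
  exact lintegral_prod _ (hf.comp mp.measurable).aemeasurable

lemma ae_of_ae_sphere {P : E → Prop}
    (h : ∀ᵐ ξ : Metric.sphere (0 : E) 1 ∂(volume : Measure E).toSphere, P ξ) :
    ∀ᵐ x : E, x ≠ 0 → P (‖x‖⁻¹ • x) := by
  have h1 := (Measure.measurePreserving_homeomorphUnitSphereProd
    (volume : Measure E)).quasiMeasurePreserving.ae (Measure.quasiMeasurePreserving_fst.ae h)
  have h2 : ∀ᵐ z : ({0}ᶜ : Set E) ∂(volume.comap Subtype.val), P (‖(z : E)‖⁻¹ • (z : E)) := by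
    filter_upwards [h1] with z hz
    simpa using hz
  exact (ae_restrict_iff' (measurableSet_singleton (0 : E)).compl).1
    ((ae_restrict_iff_subtype (measurableSet_singleton (0 : E)).compl).2 h2)

lemma lintegral_ball_lt_top_of_homogeneous [Nontrivial E] {φ : E → ℝ≥0∞} (hφ : Measurable φ)
    (hh : ∀ᵐ ξ : Metric.sphere (0 : E) 1 ∂(volume : Measure E).toSphere,
      ∀ r : ℝ, 0 < r → φ (r • (ξ : E)) = ENNReal.ofReal r ^ 2 * φ ξ)
    (hI : ∫⁻ ξ : Metric.sphere (0 : E) 1, φ ξ ∂(volume : Measure E).toSphere < ∞) (R : ℝ) :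
    ∫⁻ x in Metric.ball 0 R, φ x < ∞ := by
  rcases le_or_gt R 0 with hR | hR
  · simp [Metric.ball_eq_empty.2 hR]
  have mp := Measure.measurePreserving_homeomorphUnitSphereProd (volume : Measure E)
  set N := Measure.volumeIoiPow (Module.finrank ℝ E - 1)
  have hm0 : MeasurableSet ({0}ᶜ : Set E) := (measurableSet_singleton _).compl
  set f : E → ℝ≥0∞ := (Metric.ball 0 R).indicator φ with hf
  have hfm : Measurable f := hφ.indicator measurableSet_ball
  have hg : Measurable fun p : Metric.sphere (0 : E) 1 × Ioi (0 : ℝ) => f (p.2.1 • (p.1 : E)) := by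
    fun_prop
  calc ∫⁻ x in Metric.ball 0 R, φ x = ∫⁻ x, f x := (lintegral_indicator measurableSet_ball _).symm
    _ = ∫⁻ x in ({0}ᶜ : Set E), f x := by rw [restrict_compl_singleton]
    _ = ∫⁻ z : ({0}ᶜ : Set E), f z ∂(volume.comap Subtype.val) :=
        (lintegral_subtype_comap hm0 f).symm
    _ = ∫⁻ p, f (p.2.1 • (p.1 : E)) ∂((volume : Measure E).toSphere.prod N) := by
        rw [← mp.lintegral_comp hg]
        refine lintegral_congr fun z => ?_
        have hz : (z : E) ≠ 0 := z.2
        simp [smul_smul, mul_inv_cancel₀ (norm_ne_zero_iff.2 hz)]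
    _ = ∫⁻ ξ, ∫⁻ r : Ioi (0 : ℝ), f (r.1 • (ξ : E)) ∂N ∂(volume : Measure E).toSphere :=
        lintegral_prod _ hg.aemeasurable
    _ ≤ ∫⁻ ξ : Metric.sphere (0 : E) 1, (ENNReal.ofReal R ^ 2 * N (Iio ⟨R, hR⟩)) * φ ξ
          ∂(volume : Measure E).toSphere := by
        refine lintegral_mono_ae ?_
        filter_upwards [hh] with ξ hξ
        calc ∫⁻ r : Ioi (0 : ℝ), f (r.1 • (ξ : E)) ∂N
            ≤ ∫⁻ r : Ioi (0 : ℝ), (Iio ⟨R, hR⟩).indicator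
                (fun _ => ENNReal.ofReal R ^ 2 * φ ξ) r ∂N := by
              refine lintegral_mono fun r => ?_
              have hn : ‖r.1 • (ξ : E)‖ = r.1 := by
                rw [norm_smul, norm_eq_of_mem_sphere ξ, mul_one, Real.norm_of_nonneg r.2.out.le]
              by_cases hr : r.1 < R
              · have h1 : r.1 • (ξ : E) ∈ Metric.ball (0 : E) R := by
                  rw [mem_ball_zero_iff, hn]; exact hr
                have h2 : r ∈ Iio (⟨R, hR⟩ : Ioi (0 : ℝ)) := hr
                rw [hf, indicator_of_mem h1, indicator_of_mem h2, hξ _ r.2.out]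
                gcongr
              · have h1 : r.1 • (ξ : E) ∉ Metric.ball (0 : E) R := by
                  rw [mem_ball_zero_iff, hn]; exact hr
                rw [hf, indicator_of_notMem h1]
                exact zero_le
          _ = _ := by
              rw [lintegral_indicator measurableSet_Iio, setLIntegral_const]
              ring
    _ = (ENNReal.ofReal R ^ 2 * N (Iio ⟨R, hR⟩)) *
          ∫⁻ ξ : Metric.sphere (0 : E) 1, φ ξ ∂(volume : Measure E).toSphere :=
        lintegral_const_mul _ (hφ.comp measurable_subtype_coe)
    _ < ∞ := by
        refine ENNReal.mul_lt_top (ENNReal.mul_lt_top (by simp) ?_) hI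
        simp [N, Measure.volumeIoiPow_apply_Iio]

end Geometry

section Directional

variable {n : ℕ}

/-- The difference quotient `(u(x + hζ) - u(x)) · ζ / h`. -/
noncomputable def diffQuot (u : EuclideanSpace ℝ (Fin n) → EuclideanSpace ℝ (Fin n)) (h : ℝ)
    (ζ x : EuclideanSpace ℝ (Fin n)) : ℝ :=
  inner ℝ (u (x + h • ζ) - u x) ζ / h

/-- The limit of the difference quotients in the direction `ζ` along `h = 1 / (k + 1)`. -/
noncomputable def dirDeriv (u : EuclideanSpace ℝ (Fin n) → EuclideanSpace ℝ (Fin n))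
    (ζ x : EuclideanSpace ℝ (Fin n)) : ℝ :=
  (limsup (fun k : ℕ => (diffQuot u (1 / ((k : ℝ) + 1)) ζ x : EReal)) atTop).toReal

/-- Almost every slice of `u` in the direction `ζ` has locally bounded variation. -/
def IsGoodDir (Ω : Set (EuclideanSpace ℝ (Fin n)))
    (u : EuclideanSpace ℝ (Fin n) → EuclideanSpace ℝ (Fin n)) (ζ : EuclideanSpace ℝ (Fin n)) :
    Prop :=
  ∀ᵐ y : (Submodule.span ℝ {ζ})ᗮ, IsBVLoc (sliceFun u ζ y) (sliceSet Ω ζ y)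

variable {Ω : Set (EuclideanSpace ℝ (Fin n))}
  {u w : EuclideanSpace ℝ (Fin n) → EuclideanSpace ℝ (Fin n)} {ζ : EuclideanSpace ℝ (Fin n)}

section Measurability

variable {α : Type*} [MeasurableSpace α] {f g : α → EuclideanSpace ℝ (Fin n)}

lemma measurable_diffQuot (hw : Measurable w) (h : ℝ) (hf : Measurable f) (hg : Measurable g) :
    Measurable fun a => diffQuot w h (f a) (g a) := by
  unfold diffQuot
  fun_prop

lemma measurable_dirDeriv (hw : Measurable w) (hf : Measurable f) (hg : Measurable g) :
    Measurable fun a => dirDeriv w (f a) (g a) := by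
  unfold dirDeriv
  refine Measurable.ereal_toReal (Measurable.limsup fun k => ?_)
  exact (measurable_diffQuot hw _ hf hg).coe_real_ereal

end Measurability

lemma dirDeriv_eq {x : EuclideanSpace ℝ (Fin n)} {d : ℝ}
    (h : Tendsto (fun k : ℕ => diffQuot u (1 / ((k : ℝ) + 1)) ζ x) atTop (𝓝 d)) :
    dirDeriv u ζ x = d := by
  have h' : Tendsto (fun k : ℕ => (diffQuot u (1 / ((k : ℝ) + 1)) ζ x : EReal)) atTop (𝓝 d) :=
    (continuous_coe_real_ereal.tendsto d).comp h
  rw [dirDeriv, h'.limsup_eq, EReal.toReal_coe]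

lemma diffQuot_slice (h t : ℝ) (y : EuclideanSpace ℝ (Fin n)) :
    diffQuot u h ζ (y + t • ζ) = (sliceFun u ζ y (t + h) - sliceFun u ζ y t) / h := by
  rw [diffQuot, sliceFun, sliceFun, inner_sub_left, add_smul, add_assoc]

lemma diffQuot_smul {r : ℝ} (hr : r ≠ 0) (h : ℝ) (x : EuclideanSpace ℝ (Fin n)) :
    diffQuot u h (r • ζ) x = r ^ 2 * diffQuot u (h * r) ζ x := by
  rcases eq_or_ne h 0 with rfl | hh
  · simp [diffQuot]
  · rw [diffQuot, diffQuot, smul_smul, inner_smul_right]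
    field_simp

lemma isOpen_sliceSet (hΩ : IsOpen Ω) (ζ y : EuclideanSpace ℝ (Fin n)) :
    IsOpen (sliceSet Ω ζ y) :=
  hΩ.preimage (by fun_prop : Continuous fun t : ℝ => y + t • ζ)

lemma ae_slice_congr (hζ : ζ ≠ 0) (hw : ∀ᵐ x, x ∈ Ω → w x = u x) :
    ∀ᵐ y : (Submodule.span ℝ {ζ})ᗮ, ∀ᵐ t, t ∈ sliceSet Ω ζ y →
      sliceFun w ζ y t = sliceFun u ζ y t := by
  filter_upwards [ae_slice_of_ae hζ hw] with y hy
  filter_upwards [hy] with t ht hmem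
  rw [sliceFun, sliceFun, ht hmem]

lemma ae_orthogonal_congr {K K' : Submodule ℝ (EuclideanSpace ℝ (Fin n))} (hK : K = K')
    {P : EuclideanSpace ℝ (Fin n) → Prop} (h : ∀ᵐ y : Kᗮ, P y) : ∀ᵐ y : K'ᗮ, P y := by
  subst hK
  exact h

lemma IsGoodDir.smul (hΩ : IsOpen Ω) (h : IsGoodDir Ω u ζ) {r : ℝ} (hr : 0 < r) :
    IsGoodDir Ω u (r • ζ) := by
  refine ae_orthogonal_congr (Submodule.span_singleton_smul_eq (IsUnit.mk0 _ hr.ne') ζ).symm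
    (P := fun y => IsBVLoc (sliceFun u (r • ζ) y) (sliceSet Ω (r • ζ) y)) ?_
  filter_upwards [h] with y hy
  have e1 : sliceFun u (r • ζ) y = fun t => r * sliceFun u ζ y (r * t) := by
    ext t
    rw [sliceFun, sliceFun, smul_smul, inner_smul_right, mul_comm t r]
  have e2 : sliceSet Ω (r • ζ) y = {t | r * t ∈ sliceSet Ω ζ y} := by
    ext t
    simp only [sliceSet, mem_ofPred_eq, smul_smul, mul_comm t r]
  rw [e1, e2]
  exact hy.comp_mul_left (isOpen_sliceSet hΩ _ _) hr

lemma ae_isGoodDir (hn : 1 ≤ n) (hΩ : IsOpen Ω)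
    (h : ∀ᵐ ξ : Metric.sphere (0 : EuclideanSpace ℝ (Fin n)) 1
      ∂(volume : Measure (EuclideanSpace ℝ (Fin n))).toSphere, IsGoodDir Ω u ξ) :
    ∀ᵐ ζ : EuclideanSpace ℝ (Fin n), ζ ≠ 0 ∧ IsGoodDir Ω u ζ := by
  have : Nonempty (Fin n) := ⟨⟨0, hn⟩⟩
  have h0 : ∀ᵐ ζ : EuclideanSpace ℝ (Fin n), ζ ≠ 0 := by simp [ae_iff]
  filter_upwards [h0, ae_of_ae_sphere h] with ζ hζ h1
  refine ⟨hζ, ?_⟩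
  have := (h1 hζ).smul hΩ (norm_pos_iff.2 hζ)
  rwa [smul_smul, mul_inv_cancel₀ (norm_ne_zero_iff.2 hζ), one_smul] at this

lemma one_div_add_one_tendsto :
    Tendsto (fun k : ℕ => 1 / ((k : ℝ) + 1)) atTop (𝓝 0) :=
  tendsto_one_div_add_atTop_nhds_zero_nat

lemma ae_slice_dirDeriv_eq_bvGrad (hΩ : IsOpen Ω) (hw : ∀ᵐ x, x ∈ Ω → w x = u x) (hζ : ζ ≠ 0)
    (h : IsGoodDir Ω u ζ) :
    ∀ᵐ y : (Submodule.span ℝ {ζ})ᗮ, ∀ᵐ t, t ∈ sliceSet Ω ζ y →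
      dirDeriv w ζ (y + t • ζ) = bvGrad (sliceFun u ζ y) (sliceSet Ω ζ y) t := by
  filter_upwards [h, ae_slice_congr hζ hw] with y hy hc
  filter_upwards [hy.ae_tendsto_slope (isOpen_sliceSet hΩ _ _) hc (fun k => by positivity)
    one_div_add_one_tendsto] with t ht hmem
  refine dirDeriv_eq ?_
  simp_rw [diffQuot_slice]
  exact ht hmem

lemma IsGoodDir.ae_tendsto_diffQuot (hΩ : IsOpen Ω) (hwm : Measurable w)
    (hw : ∀ᵐ x, x ∈ Ω → w x = u x) (hζ : ζ ≠ 0) (h : IsGoodDir Ω u ζ) {a : ℕ → ℝ}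
    (ha0 : ∀ k, a k ≠ 0) (ha : Tendsto a atTop (𝓝 0)) :
    ∀ᵐ x, x ∈ Ω → Tendsto (fun k => diffQuot w (a k) ζ x) atTop (𝓝 (dirDeriv w ζ x)) := by
  refine ae_of_ae_slice hζ ?_ ?_
  · have h1 : MeasurableSet {x | Tendsto (fun k => diffQuot w (a k) ζ x - dirDeriv w ζ x)
        atTop (𝓝 0)} := by
      refine measurableSet_tendsto (𝓝 0) fun k => ?_
      exact (measurable_diffQuot hwm _ measurable_const measurable_id).sub
        (measurable_dirDeriv hwm measurable_const measurable_id)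
    have e : {x | x ∈ Ω → Tendsto (fun k => diffQuot w (a k) ζ x) atTop (𝓝 (dirDeriv w ζ x))} =
        Ωᶜ ∪ {x | Tendsto (fun k => diffQuot w (a k) ζ x - dirDeriv w ζ x) atTop (𝓝 0)} := by
      ext x
      rw [mem_union, mem_ofPred_eq, mem_ofPred_eq, imp_iff_not_or, mem_compl_iff,
        tendsto_sub_nhds_zero_iff]
    rw [e]
    exact hΩ.measurableSet.compl.union h1
  · filter_upwards [h, ae_slice_congr hζ hw, ae_slice_dirDeriv_eq_bvGrad hΩ hw hζ h] with y hy hc hd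
    filter_upwards [hd, hy.ae_tendsto_slope (isOpen_sliceSet hΩ _ _) hc ha0 ha] with t h1 h2 hmem
    rw [h1 hmem]
    simp_rw [diffQuot_slice]
    exact h2 hmem

lemma IsGoodDir.ae_dirDeriv_smul (hΩ : IsOpen Ω) (hwm : Measurable w)
    (hw : ∀ᵐ x, x ∈ Ω → w x = u x) (hζ : ζ ≠ 0) (h : IsGoodDir Ω u ζ) {r : ℝ} (hr : 0 < r) :
    ∀ᵐ x, x ∈ Ω → dirDeriv w (r • ζ) x = r ^ 2 * dirDeriv w ζ x := by
  have hlim : Tendsto (fun k : ℕ => 1 / ((k : ℝ) + 1) * r) atTop (𝓝 0) := by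
    simpa using one_div_add_one_tendsto.mul_const r
  filter_upwards [h.ae_tendsto_diffQuot hΩ hwm hw hζ (fun k => by positivity) hlim] with x hx hmem
  refine dirDeriv_eq ?_
  simp_rw [diffQuot_smul hr.ne']
  exact (hx hmem).const_mul _

/-- At `(ζ, x)` the difference quotients in the direction `ζ` converge to `dirDeriv w ζ x` in the
essential sense. -/
def HasEssDeriv (w : EuclideanSpace ℝ (Fin n) → EuclideanSpace ℝ (Fin n))
    (ζ x : EuclideanSpace ℝ (Fin n)) : Prop :=
  ∀ j : ℕ, ∃ m : ℕ, ∀ᵐ s : ℝ, |s| < 1 / ((m : ℝ) + 1) →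
    |inner ℝ (w (x + s • ζ) - w x) ζ - s * dirDeriv w ζ x| ≤ 1 / ((j : ℝ) + 1) * |s|

lemma measurableSet_hasEssDeriv (hwm : Measurable w) :
    MeasurableSet {p : EuclideanSpace ℝ (Fin n) × EuclideanSpace ℝ (Fin n) |
      HasEssDeriv w p.1 p.2} := by
  simp only [HasEssDeriv, ofPred_forall, ofPred_exists]
  refine MeasurableSet.iInter fun j => MeasurableSet.iUnion fun m => ?_
  simp only [ae_iff]
  have hS : MeasurableSet {q : (EuclideanSpace ℝ (Fin n) × EuclideanSpace ℝ (Fin n)) × ℝ |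
      ¬ (|q.2| < 1 / ((m : ℝ) + 1) →
      |inner ℝ (w (q.1.2 + q.2 • q.1.1) - w q.1.2) q.1.1 - q.2 * dirDeriv w q.1.1 q.1.2|
        ≤ 1 / ((j : ℝ) + 1) * |q.2|)} := by
    have hd' : Measurable fun q : (EuclideanSpace ℝ (Fin n) × EuclideanSpace ℝ (Fin n)) × ℝ =>
        dirDeriv w q.1.1 q.1.2 := 
      measurable_dirDeriv hwm (by fun_prop) (by fun_prop)
    have m1 : Measurable fun q : (EuclideanSpace ℝ (Fin n) × EuclideanSpace ℝ (Fin n)) × ℝ =>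
        |inner ℝ (w (q.1.2 + q.2 • q.1.1) - w q.1.2) q.1.1 - q.2 * dirDeriv w q.1.1 q.1.2| := by
      simp only [← Real.norm_eq_abs]
      fun_prop
    have m2 : Measurable fun q : (EuclideanSpace ℝ (Fin n) × EuclideanSpace ℝ (Fin n)) × ℝ =>
        |q.2| := by
      simp only [← Real.norm_eq_abs]
      fun_prop
    refine MeasurableSet.compl ?_
    simp only [imp_iff_not_or]
    exact (measurableSet_lt m2 measurable_const).compl.union
      (measurableSet_le m1 (m2.const_mul _))
  exact (measurable_measure_prodMk_left hS) (measurableSet_singleton 0)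

lemma IsGoodDir.ae_hasEssDeriv (hΩ : IsOpen Ω) (hwm : Measurable w)
    (hw : ∀ᵐ x, x ∈ Ω → w x = u x) (hζ : ζ ≠ 0) (h : IsGoodDir Ω u ζ) :
    ∀ᵐ x, x ∈ Ω → HasEssDeriv w ζ x := by
  refine ae_of_ae_slice hζ ?_ ?_
  · simp only [imp_iff_not_or, ofPred_or]
    have h : Measurable fun x : EuclideanSpace ℝ (Fin n) => (ζ, x) :=
      measurable_const.prodMk measurable_id
    exact hΩ.measurableSet.compl.union (h (measurableSet_hasEssDeriv hwm))
  · filter_upwards [h, ae_slice_congr hζ hw, ae_slice_dirDeriv_eq_bvGrad hΩ hw hζ h] with y hy hc hd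
    filter_upwards [hd, hy.ae_essential_deriv (isOpen_sliceSet hΩ _ _) hc] with t h1 h2 hmem j
    obtain ⟨δ, hδ, hae⟩ := h2 hmem (1 / ((j : ℝ) + 1)) (by positivity)
    obtain ⟨m, hm⟩ := exists_nat_one_div_lt hδ
    refine ⟨m, ?_⟩
    filter_upwards [hae] with s hs hsm
    rw [h1 hmem, inner_sub_left, add_assoc, ← add_smul]
    exact hs (hsm.trans hm)

lemma IsGoodDir.lintegral_dirDeriv_le (hΩ : IsOpen Ω) (hwm : Measurable w)
    (hw : ∀ᵐ x, x ∈ Ω → w x = u x) (hζ : ‖ζ‖ = 1) (h : IsGoodDir Ω u ζ) :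
    ∫⁻ x in Ω, ‖dirDeriv w ζ x‖ₑ ≤
      ∫⁻ y : (Submodule.span ℝ {ζ})ᗮ, sliceEnergy u Ω Ω ζ y := by
  have hζ0 : ζ ≠ 0 := fun h0 => by simp [h0] at hζ
  have hm : Measurable fun x => ‖dirDeriv w ζ x‖ₑ := 
    (measurable_dirDeriv hwm measurable_const measurable_id).enorm
  rw [← lintegral_indicator hΩ.measurableSet, lintegral_slice hζ (hm.indicator hΩ.measurableSet)]
  refine lintegral_mono_ae ?_
  filter_upwards [h, ae_slice_dirDeriv_eq_bvGrad hΩ hw hζ0 h] with y hy hd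
  have hA := isOpen_sliceSet hΩ ζ y
  calc ∫⁻ t : ℝ, Ω.indicator (fun x => ‖dirDeriv w ζ x‖ₑ) (y + t • ζ)
      = ∫⁻ t, (sliceSet Ω ζ y).indicator
          (fun t => ‖bvGrad (sliceFun u ζ y) (sliceSet Ω ζ y) t‖ₑ) t := by
        refine lintegral_congr_ae ?_
        filter_upwards [hd] with t ht
        by_cases hmem : t ∈ sliceSet Ω ζ y
        · have h' : (y : EuclideanSpace ℝ (Fin n)) + t • ζ ∈ Ω := hmem
          rw [indicator_of_mem hmem, indicator_of_mem h', ht hmem]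
        · have h' : (y : EuclideanSpace ℝ (Fin n)) + t • ζ ∉ Ω := hmem
          rw [indicator_of_notMem hmem, indicator_of_notMem h']
    _ = ∫⁻ t in sliceSet Ω ζ y, ‖bvGrad (sliceFun u ζ y) (sliceSet Ω ζ y) t‖ₑ :=
        lintegral_indicator hA.measurableSet _
    _ ≤ _ := (hy.lintegral_bvGrad_le hA).trans le_self_add

end Directional

section Translation

variable {E : Type*} [NormedAddCommGroup E] [InnerProductSpace ℝ E] [FiniteDimensional ℝ E]
  [MeasurableSpace E] [BorelSpace E]

/-- Translations act continuously on `L¹`. -/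
lemma tendsto_eLpNorm_translate_sub {Φ : E → ℝ} (hΦ : Integrable Φ) {a : ℕ → E}
    (ha : Tendsto a atTop (𝓝 0)) :
    Tendsto (fun k => eLpNorm (fun x => Φ (a k + x) - Φ x) 1 volume) atTop (𝓝 0) := by
  have : Fact ((1 : ℝ≥0∞) ≠ ∞) := ⟨ENNReal.one_ne_top⟩
  have hM : MemLp Φ 1 := memLp_one_iff_integrable.2 hΦ
  have h1 : Tendsto (fun k => DomAddAct.mk (a k) +ᵥ hM.toLp Φ) atTop (𝓝 (hM.toLp Φ)) := by
    have hc : Tendsto (fun k => DomAddAct.mk (a k)) atTop (𝓝 (DomAddAct.mk (0 : E))) :=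
      (DomAddAct.continuous_mk.tendsto 0).comp ha
    have := hc.vadd (tendsto_const_nhds (x := hM.toLp Φ))
    rwa [DomAddAct.mk_zero, zero_vadd] at this
  have h2 := tendsto_iff_edist_tendsto_0.1 h1
  refine h2.congr fun k => ?_
  rw [DomAddAct.mk_vadd_toLp, Lp.edist_toLp_toLp]
  rfl

lemma exists_subseq_tendsto_translate_of_eLpNorm {Φ : ℕ → E → ℝ} {Ψ : E → ℝ}
    (hΦ : ∀ k, Measurable (Φ k)) (hΨm : Measurable Ψ) (hΨ : Integrable Ψ)
    (h1 : Tendsto (fun k => eLpNorm (fun x => Φ k x - Ψ x) 1 volume) atTop (𝓝 0)) {a : ℕ → E}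
    (ha : Tendsto a atTop (𝓝 0)) :
    ∃ φ : ℕ → ℕ, StrictMono φ ∧
      ∀ᵐ x, Tendsto (fun k => Φ (φ k) (a (φ k) + x)) atTop (𝓝 (Ψ x)) := by
  have h2 := tendsto_eLpNorm_translate_sub hΨ ha
  have h3 : TendstoInMeasure volume (fun k x => Φ k (a k + x)) atTop Ψ := by
    refine tendstoInMeasure_of_tendsto_eLpNorm one_ne_zero
      (fun k => ((hΦ k).comp (measurable_const_add (a k))).aestronglyMeasurable)
      hΨm.aestronglyMeasurable ?_
    refine tendsto_of_tendsto_of_tendsto_of_le_of_le tendsto_const_nhds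
      (by simpa using h1.add h2) (fun _ => zero_le) fun k => ?_
    have e1 : ((fun x => Φ k (a k + x)) - Ψ) =
        (fun x => Φ k (a k + x) - Ψ (a k + x)) + fun x => Ψ (a k + x) - Ψ x := by
      ext x; simp
    have m1 : AEStronglyMeasurable (fun x => Φ k x - Ψ x) volume :=
      ((hΦ k).sub hΨm).aestronglyMeasurable
    have e2 : eLpNorm (fun x => Φ k (a k + x) - Ψ (a k + x)) 1 volume =
        eLpNorm (fun x => Φ k x - Ψ x) 1 volume :=
      eLpNorm_comp_measurePreserving (g := fun x => Φ k x - Ψ x) (f := fun x => a k + x) m1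
        (measurePreserving_add_left volume (a k))
    simp only [e1, ← e2]
    refine eLpNorm_add_le ?_ ?_ le_rfl
    · exact m1.comp_measurePreserving (f := fun x => a k + x)
        (measurePreserving_add_left volume (a k))
    · exact ((hΨm.comp (measurable_const_add (a k))).sub hΨm).aestronglyMeasurable
  exact h3.exists_seq_tendsto_ae

/-- Almost everywhere convergence survives small translations of the argument, along a
subsequence. -/
lemma exists_subseq_tendsto_translate {Ω : Set E} (hΩ : IsOpen Ω) {f : ℕ → E → ℝ} {g : E → ℝ}
    (hf : ∀ k, Measurable (f k)) (hg : Measurable g)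
    (hlim : ∀ᵐ x, x ∈ Ω → Tendsto (fun k => f k x) atTop (𝓝 (g x))) {a : ℕ → E}
    (ha : Tendsto a atTop (𝓝 0)) :
    ∃ φ : ℕ → ℕ, StrictMono φ ∧
      ∀ᵐ x, x ∈ Ω → Tendsto (fun k => f (φ k) (x + a (φ k))) atTop (𝓝 (g x)) := by
  let W : E → ℝ := fun x => (1 + ‖x‖) ^ (-((Module.finrank ℝ E : ℝ) + 1))
  have hWI : Integrable W := integrable_one_add_norm (by linarith)
  have hWpos : ∀ x, 0 < W x := fun x => by positivity
  have hWc : Continuous W := Continuous.rpow_const (by fun_prop)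
    fun x => Or.inl (by positivity)
  let F : (E → ℝ) → E → ℝ := fun f => Ω.indicator fun x => Real.arctan (f x) * W x
  have hFm : ∀ {f : E → ℝ}, Measurable f → Measurable (F f) := fun hf =>
    (hf.arctan.mul hWc.measurable).indicator hΩ.measurableSet
  have hFb : ∀ (f : E → ℝ) x, ‖F f x‖ ≤ 2 * W x := by
    intro f x
    have h2 : |Real.arctan (f x)| ≤ 2 := abs_le.2
      ⟨by linarith [Real.neg_pi_div_two_lt_arctan (f x), Real.pi_le_four],
        by linarith [Real.arctan_lt_pi_div_two (f x), Real.pi_le_four]⟩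
    refine (norm_indicator_le_norm_self _ x).trans ?_
    rw [norm_mul, Real.norm_eq_abs, Real.norm_of_nonneg (hWpos x).le]
    gcongr
  have hFI : ∀ {f : E → ℝ}, Measurable f → Integrable (F f) := fun {f} hf =>
    (hWI.const_mul 2).mono' (hFm hf).aestronglyMeasurable (Eventually.of_forall (hFb f))
  have h1 : Tendsto (fun k => eLpNorm (fun x => F (f k) x - F g x) 1 volume) atTop (𝓝 0) := by
    simp_rw [eLpNorm_one_eq_lintegral_enorm]
    have := tendsto_lintegral_of_dominated_convergence (μ := (volume : Measure E))
      (F := fun k x => ‖F (f k) x - F g x‖ₑ) (f := fun _ => 0)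
      (fun x => ‖4 * W x‖ₑ) (fun k => ((hFm (hf k)).sub (hFm hg)).enorm)
      (fun k => Eventually.of_forall fun x => by
        rw [enorm_le_iff_norm_le, Real.norm_of_nonneg (mul_nonneg (by norm_num) (hWpos x).le)]
        refine (norm_sub_le _ _).trans ?_
        linarith [hFb (f k) x, hFb g x])
      (hWI.const_mul 4).2.ne (by
        filter_upwards [hlim] with x hx
        have : Tendsto (fun k => F (f k) x) atTop (𝓝 (F g x)) := by
          by_cases hxΩ : x ∈ Ω
          · simp only [F, indicator_of_mem hxΩ]
            exact ((Real.continuous_arctan.tendsto _).comp (hx hxΩ)).mul_const _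
          · simp only [F, indicator_of_notMem hxΩ]
            exact tendsto_const_nhds
        have h0 := (this.sub_const (F g x)).enorm
        simpa using h0)
    simpa using this
  obtain ⟨φ, hφ, hae⟩ := exists_subseq_tendsto_translate_of_eLpNorm (fun k => hFm (hf k)) (hFm hg)
    (hFI hg) h1 ha
  refine ⟨φ, hφ, ?_⟩
  filter_upwards [hae] with x hx hxΩ
  have hax : Tendsto (fun k => a (φ k) + x) atTop (𝓝 x) := by
    simpa using (ha.comp hφ.tendsto_atTop).add_const x
  have hev : ∀ᶠ k in atTop, a (φ k) + x ∈ Ω := hax (hΩ.mem_nhds hxΩ)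
  have h4 : Tendsto (fun k => F (f (φ k)) (a (φ k) + x) / W (a (φ k) + x)) atTop
      (𝓝 (F g x / W x)) := hx.div ((hWc.tendsto x).comp hax) (hWpos x).ne'
  have h5 : Tendsto (fun k => Real.arctan (f (φ k) (a (φ k) + x))) atTop
      (𝓝 (Real.arctan (g x))) := by
    have e : F g x / W x = Real.arctan (g x) := by
      simp only [F, indicator_of_mem hxΩ]
      exact mul_div_cancel_right₀ _ (hWpos x).ne'
    rw [e] at h4
    refine h4.congr' ?_
    filter_upwards [hev] with k hk
    simp only [F, indicator_of_mem hk]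
    exact mul_div_cancel_right₀ _ (hWpos _).ne'
  have h6 := (Real.continuousAt_tan.2 (Real.cos_arctan_pos (g x)).ne').tendsto.comp h5
  simpa [Function.comp_def, Real.tan_arctan, add_comm] using h6

end Translation

section Parallelogram

variable {n : ℕ} {Ω : Set (EuclideanSpace ℝ (Fin n))}
  {u w : EuclideanSpace ℝ (Fin n) → EuclideanSpace ℝ (Fin n)}

lemma diffQuot_parallelogram (h : ℝ) (ξ η x : EuclideanSpace ℝ (Fin n)) :
    diffQuot w h (ξ + η) x + (diffQuot w h (ξ - η) (x + h • η) - diffQuot w h ξ (x + h • η)) =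
      diffQuot w h ξ x + diffQuot w h η x + diffQuot w h η (x + h • ξ) := by
  have e1 : x + h • η + h • (ξ - η) = x + h • ξ := by rw [smul_sub]; abel
  have e2 : x + h • η + h • ξ = x + h • (ξ + η) := by rw [smul_add]; abel
  have e3 : x + h • ξ + h • η = x + h • (ξ + η) := by rw [smul_add]; abel
  simp only [diffQuot, e1, e2, e3, inner_sub_left, inner_add_right, inner_sub_right]
  ring

lemma ae_dirDeriv_parallelogram (hΩ : IsOpen Ω) (hwm : Measurable w)
    (hw : ∀ᵐ x, x ∈ Ω → w x = u x) {ξ η : EuclideanSpace ℝ (Fin n)}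
    (h1 : ξ ≠ 0 ∧ IsGoodDir Ω u ξ) (h2 : η ≠ 0 ∧ IsGoodDir Ω u η)
    (h3 : ξ + η ≠ 0 ∧ IsGoodDir Ω u (ξ + η)) (h4 : ξ - η ≠ 0 ∧ IsGoodDir Ω u (ξ - η)) :
    ∀ᵐ x, x ∈ Ω → dirDeriv w (ξ + η) x + dirDeriv w (ξ - η) x =
      2 * dirDeriv w ξ x + 2 * dirDeriv w η x := by
  set a : ℕ → ℝ := fun k => 1 / ((k : ℝ) + 1) with ha
  have ha0 : ∀ k, a k ≠ 0 := fun k => by positivity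
  have hat : Tendsto a atTop (𝓝 0) := one_div_add_one_tendsto
  have mQ : ∀ (h : ℝ) ζ, Measurable fun x => diffQuot w h ζ x := fun h ζ =>
    measurable_diffQuot hwm h measurable_const measurable_id
  have mD : ∀ ζ, Measurable fun x => dirDeriv w ζ x := fun ζ =>
    measurable_dirDeriv hwm measurable_const measurable_id
  have hsm : ∀ (b : ℕ → ℝ) (ζ : EuclideanSpace ℝ (Fin n)), Tendsto b atTop (𝓝 0) →
      Tendsto (fun k => b k • ζ) atTop (𝓝 0) := fun b ζ hb => by simpa using hb.smul_const ζ
  have lim : ∀ ζ, ζ ≠ 0 ∧ IsGoodDir Ω u ζ → ∀ᵐ x, x ∈ Ω →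
      Tendsto (fun k => diffQuot w (a k) ζ x) atTop (𝓝 (dirDeriv w ζ x)) := fun ζ hζ =>
    hζ.2.ae_tendsto_diffQuot hΩ hwm hw hζ.1 ha0 hat
  obtain ⟨φ, hφ, hlim1⟩ := exists_subseq_tendsto_translate hΩ
    (f := fun k x => diffQuot w (a k) (ξ - η) x - diffQuot w (a k) ξ x)
    (g := fun x => dirDeriv w (ξ - η) x - dirDeriv w ξ x)
    (fun k => (mQ _ _).sub (mQ _ _)) ((mD _).sub (mD _))
    (by
      filter_upwards [lim _ h4, lim _ h1] with x hx hx' hmem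
      exact (hx hmem).sub (hx' hmem))
    (hsm a η hat)
  obtain ⟨ψ, hψ, hlim2⟩ := exists_subseq_tendsto_translate hΩ
    (f := fun k x => diffQuot w (a (φ k)) η x) (g := fun x => dirDeriv w η x)
    (fun k => mQ _ _) (mD _)
    (by
      filter_upwards [lim _ h2] with x hx hmem
      exact (hx hmem).comp hφ.tendsto_atTop)
    (hsm (a ∘ φ) ξ (hat.comp hφ.tendsto_atTop))
  filter_upwards [hlim1, hlim2, lim _ h1, lim _ h2, lim _ h3] with x l1 l2 l3 l4 l5 hmem
  have hψt := hψ.tendsto_atTop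
  have hφψ := hφ.tendsto_atTop.comp hψt
  have lhs := ((l5 hmem).comp hφψ).add ((l1 hmem).comp hψt)
  have rhs := (((l3 hmem).comp hφψ).add ((l4 hmem).comp hφψ)).add (l2 hmem)
  have := tendsto_nhds_unique (lhs.congr fun k => diffQuot_parallelogram _ ξ η x) rhs
  linarith

end Parallelogram

section Quadratic

variable {E : Type*} [NormedAddCommGroup E] [InnerProductSpace ℝ E]

/-- A continuous function satisfying the parallelogram law is a quadratic form. -/
lemma exists_bilinear_of_continuous_parallelogram {q : E → ℝ} (hq : Continuous q)
    (h : ∀ x y, q (x + y) + q (x - y) = 2 * q x + 2 * q y) :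
    ∃ B : E →ₗ[ℝ] E →ₗ[ℝ] ℝ, (∀ x y, B x y = B y x) ∧ ∀ x, q x = B x x := by
  have h0 : q 0 = 0 := by have := h 0 0; simp at this; linarith
  let b : E → E → ℝ := fun x y => (q (x + y) - q x - q y) / 2
  have hsymm : ∀ x y, b x y = b y x := fun x y => by simp only [b, add_comm x y]; ring
  have hadd : ∀ x z y, b (x + z) y = b x y + b z y := by
    intro x z y
    have h1 := h (x + z) y
    have h2 := h x (y - z)
    have h3 := h (x + y) z
    have h4 := h y z
    rw [show x + (y - z) = x + y - z by abel, show x - (y - z) = x + z - y by abel] at h2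
    rw [show x + y + z = x + z + y by abel] at h3
    simp only [b, add_comm z y]
    linarith
  have hsmul : ∀ (c : ℝ) x y, b (c • x) y = c * b x y := by
    intro c x y
    let f : E →+ ℝ := ⟨⟨fun x => b x y, by simp [b, h0]⟩, fun x z => hadd x z y⟩
    have hf : Continuous f := by
      change Continuous fun x => (q (x + y) - q x - q y) / 2
      fun_prop
    exact map_real_smul f hf c x
  refine ⟨LinearMap.mk₂ ℝ b hadd (fun c x y => by rw [hsmul, smul_eq_mul])
    (fun x y z => by rw [hsymm, hadd, hsymm y, hsymm z])
    (fun c x y => by rw [hsymm, hsmul, hsymm, smul_eq_mul]), hsymm, fun x => ?_⟩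
  have h2 := h x x
  rw [sub_self, h0] at h2
  simp only [LinearMap.mk₂_apply, b]
  linarith

variable [FiniteDimensional ℝ E] [MeasurableSpace E] [BorelSpace E]

/-- A locally integrable function satisfying the parallelogram law almost everywhere is almost
everywhere equal to a quadratic form. -/
lemma exists_bilinear_of_ae_parallelogram {q : E → ℝ} (hq : LocallyIntegrable q)
    (h : ∀ᵐ x : E, ∀ᵐ y : E, q (x + y) + q (x - y) = 2 * q x + 2 * q y) :
    ∃ B : E →ₗ[ℝ] E →ₗ[ℝ] ℝ, (∀ x y, B x y = B y x) ∧ ∀ᵐ x, q x = B x x := by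
  let ρ : ContDiffBump (0 : E) := ⟨1, 2, one_pos, one_lt_two⟩
  set r : E → ℝ := ρ.normed volume with hr
  have hrc : Continuous r := (ρ.contDiff_normed (n := 1)).continuous
  have hrs : HasCompactSupport r := ρ.hasCompactSupport_normed
  have hri : ∫ t, r t = 1 := ρ.integral_normed
  have hrneg : ∀ t, r (-t) = r t := fun t => ρ.normed_neg t
  set c := ∫ t, r t * q t with hc
  let p : E → ℝ := fun x => (∫ t, r t * q (x - t)) - c
  have hpc : Continuous p :=
    (hrs.continuous_convolution_left (ContinuousLinearMap.lsmul ℝ ℝ) hrc hq).sub continuous_const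
  have hI : ∀ x, Integrable fun t => r t * q (x - t) := fun x =>
    (hrs.convolutionExists_left (ContinuousLinearMap.lsmul ℝ ℝ) hrc hq) x
  have hflip : ∀ x t, r (-t) * q (x - -t) = r t * q (x + t) := fun x t => by
    rw [hrneg, sub_neg_eq_add]
  have hI' : ∀ x, Integrable fun t => r t * q (x + t) := fun x => by
    simpa only [hflip] using (hI x).comp_neg
  have hint' : ∀ x, ∫ t, r t * q (x + t) = ∫ t, r t * q (x - t) := fun x => by
    rw [← integral_neg_eq_self (fun t => r t * q (x - t))]
    simp only [hflip]
  have hqp : ∀ᵐ x, q x = p x := by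
    filter_upwards [h] with x hx
    have hI0 : Integrable fun t => r t * q t := by simpa using hI' 0
    have e : ∫ t, (r t * q (x + t) + r t * q (x - t)) =
        ∫ t, (2 * q x * r t + 2 * (r t * q t)) := by
      refine integral_congr_ae ?_
      filter_upwards [hx] with t ht
      linear_combination r t * ht
    rw [integral_add (hI' x) (hI x), hint', integral_add
      ((hrc.integrable_of_hasCompactSupport hrs).const_mul _) (hI0.const_mul 2),
      integral_const_mul, integral_const_mul, hri] at e
    simp only [p]
    linarith
  have hlaw : ∀ᵐ x : E, ∀ᵐ y : E, p (x + y) + p (x - y) = 2 * p x + 2 * p y := by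
    filter_upwards [h, hqp] with x hx hx'
    have h1 := (measurePreserving_add_left volume x).quasiMeasurePreserving.ae hqp
    have h2 := (quasiMeasurePreserving_sub_left volume x).ae hqp
    filter_upwards [hx, h1, h2, hqp] with y e1 e2 e3 e4
    rw [← e2, ← e3, ← hx', ← e4, e1]
  have hall : ∀ x y, p (x + y) + p (x - y) = 2 * p x + 2 * p y := by
    have h1 : ∀ᵐ x : E, ∀ y, p (x + y) + p (x - y) = 2 * p x + 2 * p y := by
      filter_upwards [hlaw] with x hx
      have := (Continuous.ae_eq_iff_eq (volume : Measure E)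
        (f := fun y => p (x + y) + p (x - y)) (g := fun y => 2 * p x + 2 * p y)
        (by fun_prop) (by fun_prop)).1 hx
      exact fun y => congrFun this y
    intro x y
    have := (Continuous.ae_eq_iff_eq (volume : Measure E)
      (f := fun x => p (x + y) + p (x - y)) (g := fun x => 2 * p x + 2 * p y)
      (by fun_prop) (by fun_prop)).1 (h1.mono fun x hx => hx y)
    exact congrFun this x
  obtain ⟨B, hB, hB'⟩ := exists_bilinear_of_continuous_parallelogram hpc hall
  exact ⟨B, hB, hqp.mono fun x hx => hx.trans (hB' x)⟩

open scoped Pointwise in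
/-- A set which almost every ray leaves essentially immediately has density zero at the origin. -/
lemma tendsto_density_zero_of_ae_ray {N : Set E} (hN : MeasurableSet N)
    (h : ∀ᵐ z : E, ∃ δ > 0, ∀ᵐ s : ℝ, s ∈ Ioo 0 δ → s • z ∉ N) :
    Tendsto (fun r : ℝ => volume (N ∩ Metric.ball 0 r) / volume (Metric.ball (0 : E) r))
      (𝓝[>] 0) (𝓝 0) := by
  set d := Module.finrank ℝ E
  let f : ℝ → E → ℝ≥0∞ := fun r z => volume {c | c ∈ Ioo (1 : ℝ) 2 ∧ (r * c) • z ∈ N}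
  have hmeas : ∀ r : ℝ, MeasurableSet {p : E × ℝ | p.2 ∈ Ioo (1 : ℝ) 2 ∧ (r * p.2) • p.1 ∈ N} :=
    fun r => (measurableSet_Ioo.preimage measurable_snd).inter
      (hN.preimage (by fun_prop : Measurable fun p : E × ℝ => (r * p.2) • p.1))
  have hf : ∀ r, Measurable (f r) := fun r => measurable_measure_prodMk_left (hmeas r)
  have hlim : Tendsto (fun r => ∫⁻ z in Metric.ball (0 : E) 1, f r z) (𝓝[>] 0) (𝓝 0) := by
    have := tendsto_lintegral_filter_of_dominated_convergence
      (μ := volume.restrict (Metric.ball (0 : E) 1)) (l := 𝓝[>] (0 : ℝ)) (F := f) (f := fun _ => 0)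
      (fun _ => 1) (Eventually.of_forall hf) (Eventually.of_forall fun r =>
        Eventually.of_forall fun z =>
          (measure_mono fun c hc => hc.1).trans (by rw [Real.volume_Ioo]; norm_num))
      (by simp [measure_ball_lt_top.ne]) (ae_restrict_of_ae (by
        filter_upwards [h] with z hz
        obtain ⟨δ, hδ, hae⟩ := hz
        refine tendsto_const_nhds.congr' ?_
        filter_upwards [Ioo_mem_nhdsGT (half_pos hδ)] with r hr
        refine (measure_mono_null ?_ (ae_comp_mul_left hr.1.ne' hae)).symm
        rintro c ⟨hc, hcN⟩ hn
        exact hn ⟨mul_pos hr.1 (by linarith [hc.1]), by nlinarith [hc.2, hr.1, hr.2]⟩ hcN))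
    simpa using this
  have hV0 : volume (Metric.ball (0 : E) 1) ≠ 0 := (Metric.measure_ball_pos _ _ one_pos).ne'
  have hVt : volume (Metric.ball (0 : E) 1) ≠ ∞ := measure_ball_lt_top.ne
  refine tendsto_of_tendsto_of_tendsto_of_le_of_le' tendsto_const_nhds
    (h := fun r => (2 ^ d / volume (Metric.ball (0 : E) 1)) *
      ∫⁻ z in Metric.ball (0 : E) 1, f r z) ?_ (Eventually.of_forall fun _ => zero_le) ?_
  · have := ENNReal.Tendsto.const_mul (a := 2 ^ d / volume (Metric.ball (0 : E) 1)) hlim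
      (Or.inr (ENNReal.div_ne_top (by simp) hV0))
    simpa using this
  filter_upwards [self_mem_nhdsWithin] with r hr
  have hr : 0 < r := hr
  have hlow : ∀ c ∈ Ioo (1 : ℝ) 2, volume (N ∩ Metric.ball 0 r) ≤
      ENNReal.ofReal (2 * r) ^ d * volume {z : E | z ∈ Metric.ball (0 : E) 1 ∧ (r * c) • z ∈ N} := by
    intro c hc
    have hrc : 0 < r * c := mul_pos hr (by linarith [hc.1])
    calc volume (N ∩ Metric.ball 0 r)
        ≤ volume ((r * c) • {z : E | z ∈ Metric.ball (0 : E) 1 ∧ (r * c) • z ∈ N}) := by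
          refine measure_mono fun y hy => ?_
          refine ⟨(r * c)⁻¹ • y, ⟨?_, ?_⟩, smul_inv_smul₀ hrc.ne' y⟩
          · rw [mem_ball_zero_iff, norm_smul, norm_inv, Real.norm_of_nonneg hrc.le,
              inv_mul_lt_iff₀ hrc]
            have := mem_ball_zero_iff.1 hy.2
            nlinarith [hc.1]
          · rw [smul_inv_smul₀ hrc.ne']; exact hy.1
      _ = ENNReal.ofReal (r * c) ^ d *
            volume {z : E | z ∈ Metric.ball (0 : E) 1 ∧ (r * c) • z ∈ N} := by
          rw [Measure.addHaar_smul, abs_of_pos (by positivity), ENNReal.ofReal_pow hrc.le]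
      _ ≤ _ := by gcongr ENNReal.ofReal ?_ ^ d * _; nlinarith [hc.2]
  have hFub : ∫⁻ z in Metric.ball (0 : E) 1, f r z =
      ∫⁻ c in Ioo (1 : ℝ) 2, volume {z : E | z ∈ Metric.ball (0 : E) 1 ∧ (r * c) • z ∈ N} := by
    have hN' : Measurable fun p : E × ℝ => N.indicator (fun _ => (1 : ℝ≥0∞)) ((r * p.2) • p.1) :=
      (measurable_const.indicator hN).comp (by fun_prop)
    have e1 : ∀ z, f r z = ∫⁻ c in Ioo (1 : ℝ) 2, N.indicator (fun _ => 1) ((r * c) • z) := by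
      intro z
      have hm : MeasurableSet {c : ℝ | (r * c) • z ∈ N} :=
        hN.preimage (by fun_prop : Measurable fun c : ℝ => (r * c) • z)
      have : (fun c : ℝ => N.indicator (fun _ => (1 : ℝ≥0∞)) ((r * c) • z)) =
          {c : ℝ | (r * c) • z ∈ N}.indicator fun _ => 1 := by ext c; simp [indicator]
      rw [this, lintegral_indicator_const hm, one_mul, Measure.restrict_apply hm, inter_comm]
      rfl
    have e2 : ∀ c : ℝ, volume {z : E | z ∈ Metric.ball (0 : E) 1 ∧ (r * c) • z ∈ N} =
        ∫⁻ z in Metric.ball (0 : E) 1, N.indicator (fun _ => 1) ((r * c) • z) := by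
      intro c
      have hm : MeasurableSet {z : E | (r * c) • z ∈ N} :=
        hN.preimage (by fun_prop : Measurable fun z : E => (r * c) • z)
      have : (fun z : E => N.indicator (fun _ => (1 : ℝ≥0∞)) ((r * c) • z)) =
          {z : E | (r * c) • z ∈ N}.indicator fun _ => 1 := by ext c; simp [indicator]
      rw [this, lintegral_indicator_const hm, one_mul, Measure.restrict_apply hm, inter_comm]
      rfl
    simp_rw [e1, e2]
    exact lintegral_lintegral_swap hN'.aemeasurable
  have hge : volume (N ∩ Metric.ball 0 r) ≤
      ENNReal.ofReal (2 * r) ^ d * ∫⁻ z in Metric.ball (0 : E) 1, f r z := by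
    rw [hFub, ← lintegral_const_mul' _ _ (ENNReal.pow_ne_top ENNReal.ofReal_ne_top)]
    calc volume (N ∩ Metric.ball 0 r) = ∫⁻ _ in Ioo (1 : ℝ) 2, volume (N ∩ Metric.ball 0 r) := by
          rw [setLIntegral_const, Real.volume_Ioo]; norm_num
      _ ≤ _ := setLIntegral_mono' measurableSet_Ioo hlow
  rw [Measure.addHaar_ball_of_pos _ _ hr]
  have hrd : ENNReal.ofReal (r ^ d) ≠ 0 := by simpa using pow_pos hr d
  refine ENNReal.div_le_of_le_mul (hge.trans (le_of_eq ?_))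
  rw [ENNReal.ofReal_mul (by norm_num), mul_pow, ENNReal.ofReal_pow hr.le,
    ENNReal.div_eq_inv_mul]
  set V := volume (Metric.ball (0 : E) 1)
  set I := ∫⁻ z in Metric.ball (0 : E) 1, f r z
  calc ENNReal.ofReal 2 ^ d * ENNReal.ofReal r ^ d * I
      = (V⁻¹ * V) * (2 ^ d * ENNReal.ofReal r ^ d * I) := by
        rw [ENNReal.inv_mul_cancel hV0 hVt, one_mul]; norm_num
    _ = _ := by ring

end Quadratic

section SymGrad

variable {n : ℕ} {Ω : Set (EuclideanSpace ℝ (Fin n))}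
  {u w : EuclideanSpace ℝ (Fin n) → EuclideanSpace ℝ (Fin n)}

/-- The polarisation of the directional derivatives, averaged over the unit ball. -/
noncomputable def symGrad (w : EuclideanSpace ℝ (Fin n) → EuclideanSpace ℝ (Fin n))
    (x : EuclideanSpace ℝ (Fin n)) : Matrix (Fin n) (Fin n) ℝ :=
  Matrix.of fun i j => (2 * volume.real (Metric.ball (0 : EuclideanSpace ℝ (Fin n)) 1))⁻¹ *
    ∫ η in Metric.ball (0 : EuclideanSpace ℝ (Fin n)) 1,
      (dirDeriv w (EuclideanSpace.single i 1 + EuclideanSpace.single j 1 + η) x -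
        dirDeriv w (EuclideanSpace.single i 1 + η) x -
        dirDeriv w (EuclideanSpace.single j 1 + η) x + dirDeriv w η x)

lemma symGrad_isSymm (x : EuclideanSpace ℝ (Fin n)) : (symGrad w x).IsSymm := by
  ext i j
  simp only [symGrad, Matrix.transpose_apply, Matrix.of_apply]
  congr 1
  refine integral_congr_ae (Eventually.of_forall fun η => ?_)
  simp only
  rw [add_comm (EuclideanSpace.single j (1 : ℝ)) (EuclideanSpace.single i 1)]
  ring

lemma measurable_symGrad (hwm : Measurable w) (i j : Fin n) :
    Measurable fun x => symGrad w x i j := by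
  simp only [symGrad, Matrix.of_apply]
  refine Measurable.const_mul ?_ _
  refine StronglyMeasurable.measurable ?_
  refine StronglyMeasurable.integral_prod_right
    (f := fun (x : EuclideanSpace ℝ (Fin n)) (η : EuclideanSpace ℝ (Fin n)) =>
      dirDeriv w (EuclideanSpace.single i 1 + EuclideanSpace.single j 1 + η) x -
        dirDeriv w (EuclideanSpace.single i 1 + η) x -
        dirDeriv w (EuclideanSpace.single j 1 + η) x + dirDeriv w η x) ?_
  refine Measurable.stronglyMeasurable ?_
  refine Measurable.add (Measurable.sub (Measurable.sub ?_ ?_) ?_) ?_ <;>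
    exact measurable_dirDeriv hwm (by fun_prop) (by fun_prop)

/-- The quadratic form of a symmetric bilinear form read off from its matrix. -/
lemma inner_toEuclideanLin_of_bilinear
    (B : EuclideanSpace ℝ (Fin n) →ₗ[ℝ] EuclideanSpace ℝ (Fin n) →ₗ[ℝ] ℝ)
    {M : Matrix (Fin n) (Fin n) ℝ}
    (hM : ∀ i j, M i j = B (EuclideanSpace.single i 1) (EuclideanSpace.single j 1))
    (ζ : EuclideanSpace ℝ (Fin n)) :
    inner ℝ (Matrix.toEuclideanLin M ζ) ζ = B ζ ζ := by
  have hζ : ζ = ∑ i, ζ i • EuclideanSpace.single i (1 : ℝ) := by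
    have := (EuclideanSpace.basisFun (Fin n) ℝ).sum_repr ζ
    simpa using this.symm
  have e : B ζ ζ = ∑ i, ∑ j, ζ i * (ζ j *
      B (EuclideanSpace.single i 1) (EuclideanSpace.single j 1)) := by
    conv_lhs => rw [hζ]
    simp only [map_sum, map_smul, LinearMap.sum_apply, LinearMap.smul_apply, smul_eq_mul,
      Finset.mul_sum]
    rw [Finset.sum_comm]
    exact Finset.sum_congr rfl fun i _ => Finset.sum_congr rfl fun j _ => mul_left_comm _ _ _
  rw [e, PiLp.inner_apply]
  refine Finset.sum_congr rfl fun i _ => ?_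
  simp only [Matrix.toLpLin_apply, Matrix.mulVec, dotProduct, hM, RCLike.inner_apply,
    conj_trivial, Finset.mul_sum]
  refine Finset.sum_congr rfl fun j _ => ?_
  ring

lemma symGrad_eq_of_ae_bilinear
    {B : EuclideanSpace ℝ (Fin n) →ₗ[ℝ] EuclideanSpace ℝ (Fin n) →ₗ[ℝ] ℝ}
    (hB : ∀ ξ η, B ξ η = B η ξ) {x : EuclideanSpace ℝ (Fin n)}
    (h : ∀ᵐ ζ, dirDeriv w ζ x = B ζ ζ) (i j : Fin n) :
    symGrad w x i j = B (EuclideanSpace.single i 1) (EuclideanSpace.single j 1) := by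
  have hs : ∀ a : EuclideanSpace ℝ (Fin n), ∀ᵐ η, dirDeriv w (a + η) x = B (a + η) (a + η) :=
    fun a => (measurePreserving_add_left volume a).quasiMeasurePreserving.ae h
  set a : EuclideanSpace ℝ (Fin n) := EuclideanSpace.single i 1
  set b : EuclideanSpace ℝ (Fin n) := EuclideanSpace.single j 1
  have hi : ∫ η in Metric.ball (0 : EuclideanSpace ℝ (Fin n)) 1,
      (dirDeriv w (a + b + η) x - dirDeriv w (a + η) x - dirDeriv w (b + η) x + dirDeriv w η x) =
      ∫ _ in Metric.ball (0 : EuclideanSpace ℝ (Fin n)) 1, 2 * B a b := by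
    refine integral_congr_ae (ae_restrict_of_ae ?_)
    filter_upwards [hs (a + b), hs a, hs b, h] with η h1 h2 h3 h4
    rw [h1, h2, h3, h4]
    simp only [map_add, LinearMap.add_apply]
    rw [hB b a]
    ring
  have hpos : 0 < volume.real (Metric.ball (0 : EuclideanSpace ℝ (Fin n)) 1) :=
    ENNReal.toReal_pos (Metric.measure_ball_pos _ _ one_pos).ne' measure_ball_lt_top.ne
  rw [symGrad, Matrix.of_apply, hi, setIntegral_const, smul_eq_mul]
  field_simp

lemma lintegral_ball_dirDeriv_lt_top (hn : 1 ≤ n) (hΩ : IsOpen Ω) (hwm : Measurable w)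
    (hw : ∀ᵐ x, x ∈ Ω → w x = u x) (hu : IsGBVE Ω u) (R : ℝ) :
    ∫⁻ ζ in Metric.ball (0 : EuclideanSpace ℝ (Fin n)) R, ∫⁻ x in Ω, ‖dirDeriv w ζ x‖ₑ < ∞ := by
  have : Nonempty (Fin n) := ⟨⟨0, hn⟩⟩
  obtain ⟨-, hgood, lam, hlam, hE⟩ := hu
  have hgood : ∀ᵐ ξ : Metric.sphere (0 : EuclideanSpace ℝ (Fin n)) 1
      ∂(volume : Measure (EuclideanSpace ℝ (Fin n))).toSphere, IsGoodDir Ω u ξ := hgood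
  have hm : Measurable fun ζ => ∫⁻ x in Ω, ‖dirDeriv w ζ x‖ₑ :=
    Measurable.lintegral_prod_right' (f := fun p : EuclideanSpace ℝ (Fin n) ×
      EuclideanSpace ℝ (Fin n) => ‖dirDeriv w p.1 p.2‖ₑ)
      (measurable_dirDeriv hwm measurable_fst measurable_snd).enorm
  refine lintegral_ball_lt_top_of_homogeneous hm ?_ ?_ R
  · filter_upwards [hgood] with ξ hξ r hr
    have hξ0 : (ξ : EuclideanSpace ℝ (Fin n)) ≠ 0 := ne_zero_of_mem_unit_sphere ξ
    rw [← lintegral_const_mul' _ _ (ENNReal.pow_ne_top ENNReal.ofReal_ne_top)]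
    refine setLIntegral_congr_fun_ae hΩ.measurableSet ?_
    filter_upwards [hξ.ae_dirDeriv_smul hΩ hwm hw hξ0 hr] with x hx hmem
    rw [hx hmem, enorm_mul, enorm_pow, Real.enorm_of_nonneg hr.le]
  · calc _ ≤ ∫⁻ ξ : Metric.sphere (0 : EuclideanSpace ℝ (Fin n)) 1,
          (∫⁻ y : (Submodule.span ℝ {(ξ : EuclideanSpace ℝ (Fin n))})ᗮ, sliceEnergy u Ω Ω ξ y)
          ∂(volume : Measure (EuclideanSpace ℝ (Fin n))).toSphere := by
          refine lintegral_mono_ae ?_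
          filter_upwards [hgood] with ξ hξ
          exact hξ.lintegral_dirDeriv_le hΩ hwm hw (norm_eq_of_mem_sphere ξ)
      _ ≤ lam Ω := hE Ω hΩ subset_rfl
      _ < ∞ := measure_lt_top _ _

lemma integrable_dirDeriv_translate (hn : 1 ≤ n) (hΩ : IsOpen Ω) (hwm : Measurable w)
    (hw : ∀ᵐ x, x ∈ Ω → w x = u x) (hu : IsGBVE Ω u) (R : ℝ) (a : EuclideanSpace ℝ (Fin n)) :
    Integrable (fun p : EuclideanSpace ℝ (Fin n) × EuclideanSpace ℝ (Fin n) =>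
      dirDeriv w (a + p.1) p.2)
      ((volume.restrict (Metric.ball 0 R)).prod (volume.restrict Ω)) := by
  have hm : Measurable fun p : EuclideanSpace ℝ (Fin n) × EuclideanSpace ℝ (Fin n) =>
      dirDeriv w (a + p.1) p.2 := measurable_dirDeriv hwm (by fun_prop) (by fun_prop)
  refine ⟨hm.aestronglyMeasurable, ?_⟩
  rw [HasFiniteIntegral, lintegral_prod _ hm.enorm.aemeasurable]
  set φ : EuclideanSpace ℝ (Fin n) → ℝ≥0∞ := fun ζ => ∫⁻ x in Ω, ‖dirDeriv w ζ x‖ₑ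
  change ∫⁻ ζ in Metric.ball 0 R, φ (a + ζ) < ∞
  refine lt_of_le_of_lt ?_ (lintegral_ball_dirDeriv_lt_top hn hΩ hwm hw hu (R + ‖a‖))
  rw [← lintegral_indicator measurableSet_ball, ← lintegral_indicator measurableSet_ball,
    ← lintegral_add_left_eq_self ((Metric.ball 0 (R + ‖a‖)).indicator _) a]
  refine lintegral_mono fun ζ => ?_
  by_cases hζ : ζ ∈ Metric.ball (0 : EuclideanSpace ℝ (Fin n)) R
  · have h' : a + ζ ∈ Metric.ball (0 : EuclideanSpace ℝ (Fin n)) (R + ‖a‖) := by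
      rw [mem_ball_zero_iff] at *
      linarith [norm_add_le a ζ]
    rw [indicator_of_mem hζ, indicator_of_mem h']
  · rw [indicator_of_notMem hζ]
    exact zero_le

lemma integrableOn_symGrad (hn : 1 ≤ n) (hΩ : IsOpen Ω) (hwm : Measurable w)
    (hw : ∀ᵐ x, x ∈ Ω → w x = u x) (hu : IsGBVE Ω u) (i j : Fin n) :
    IntegrableOn (fun x => symGrad w x i j) Ω := by
  have hI := integrable_dirDeriv_translate hn hΩ hwm hw hu 1
  have h0 := hI 0
  simp only [zero_add] at h0
  simp only [symGrad, Matrix.of_apply]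
  exact (((((hI _).sub (hI _)).sub (hI _)).add h0).integral_prod_right).const_mul _

lemma ae_locallyIntegrable_dirDeriv (hn : 1 ≤ n) (hΩ : IsOpen Ω) (hwm : Measurable w)
    (hw : ∀ᵐ x, x ∈ Ω → w x = u x) (hu : IsGBVE Ω u) :
    ∀ᵐ x, x ∈ Ω → LocallyIntegrable fun ζ => dirDeriv w ζ x := by
  have h : ∀ N : ℕ, ∀ᵐ x, x ∈ Ω → IntegrableOn (fun ζ => dirDeriv w ζ x) (Metric.ball 0 N) := by
    intro N
    have hI := integrable_dirDeriv_translate hn hΩ hwm hw hu N 0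
    simp only [zero_add] at hI
    exact (ae_restrict_iff' hΩ.measurableSet).1 hI.prod_left_ae
  filter_upwards [ae_all_iff.2 h] with x hx hmem
  refine locallyIntegrable_iff.2 fun K hK => ?_
  obtain ⟨R, hR⟩ := hK.isBounded.subset_ball 0
  obtain ⟨N, hN⟩ := exists_nat_ge R
  exact (hx N hmem).mono_set (hR.trans (Metric.ball_subset_ball hN))

lemma ae_ae_dirDeriv_parallelogram (hΩ : IsOpen Ω) (hwm : Measurable w)
    (hw : ∀ᵐ x, x ∈ Ω → w x = u x)
    (hdir : ∀ᵐ ζ : EuclideanSpace ℝ (Fin n), ζ ≠ 0 ∧ IsGoodDir Ω u ζ) :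
    ∀ᵐ x, x ∈ Ω → ∀ᵐ ξ, ∀ᵐ η, dirDeriv w (ξ + η) x + dirDeriv w (ξ - η) x =
      2 * dirDeriv w ξ x + 2 * dirDeriv w η x := by
  have hm : MeasurableSet {q : (EuclideanSpace ℝ (Fin n) × EuclideanSpace ℝ (Fin n)) ×
      EuclideanSpace ℝ (Fin n) | q.2 ∈ Ω → dirDeriv w (q.1.1 + q.1.2) q.2 +
        dirDeriv w (q.1.1 - q.1.2) q.2 = 2 * dirDeriv w q.1.1 q.2 + 2 * dirDeriv w q.1.2 q.2} := by
    simp only [imp_iff_not_or, ofPred_or]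
    refine (hΩ.measurableSet.preimage measurable_snd).compl.union ?_
    refine measurableSet_eq_fun (Measurable.add ?_ ?_)
      (Measurable.add (Measurable.const_mul ?_ _) (Measurable.const_mul ?_ _)) <;>
    exact measurable_dirDeriv hwm (by fun_prop) (by fun_prop)
  have h : ∀ᵐ p : EuclideanSpace ℝ (Fin n) × EuclideanSpace ℝ (Fin n) ∂(volume.prod volume),
      ∀ᵐ x, x ∈ Ω → dirDeriv w (p.1 + p.2) x + dirDeriv w (p.1 - p.2) x =
        2 * dirDeriv w p.1 x + 2 * dirDeriv w p.2 x := by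
    filter_upwards [Measure.quasiMeasurePreserving_fst.ae hdir,
      Measure.quasiMeasurePreserving_snd.ae hdir,
      (quasiMeasurePreserving_add volume volume).ae hdir,
      (quasiMeasurePreserving_sub volume volume).ae hdir] with p h1 h2 h3 h4
    exact ae_dirDeriv_parallelogram hΩ hwm hw h1 h2 h3 h4
  filter_upwards [(Measure.ae_ae_comm hm).1 h] with x hx hmem
  refine Measure.ae_ae_of_ae_prod (p := fun p : EuclideanSpace ℝ (Fin n) ×
    EuclideanSpace ℝ (Fin n) => dirDeriv w (p.1 + p.2) x + dirDeriv w (p.1 - p.2) x =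
        2 * dirDeriv w p.1 x + 2 * dirDeriv w p.2 x) ?_
  filter_upwards [hx] with p hp using hp hmem

lemma measurable_inner_symGrad {α : Type*} [MeasurableSpace α] (hwm : Measurable w)
    {f g : α → EuclideanSpace ℝ (Fin n)} (hf : Measurable f) (hg : Measurable g) :
    Measurable fun a => inner ℝ (Matrix.toEuclideanLin (symGrad w (f a)) (g a)) (g a) := by
  simp only [PiLp.inner_apply, Matrix.toLpLin_apply, Matrix.mulVec, dotProduct, RCLike.inner_apply,
    conj_trivial]
  refine Finset.measurable_sum _ fun i _ => Measurable.mul (by fun_prop) ?_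
  refine Finset.measurable_sum _ fun j _ => Measurable.mul ?_ (by fun_prop)
  exact (measurable_symGrad hwm i j).comp hf

/-- The directional derivatives are given by the quadratic form of `symGrad`. -/
lemma ae_ae_dirDeriv_eq (hn : 1 ≤ n) (hΩ : IsOpen Ω) (hwm : Measurable w)
    (hw : ∀ᵐ x, x ∈ Ω → w x = u x) (hu : IsGBVE Ω u) :
    ∀ᵐ x, x ∈ Ω → ∀ᵐ ζ, dirDeriv w ζ x =
      inner ℝ (Matrix.toEuclideanLin (symGrad w x) ζ) ζ := by
  filter_upwards [ae_locallyIntegrable_dirDeriv hn hΩ hwm hw hu,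
    ae_ae_dirDeriv_parallelogram hΩ hwm hw (ae_isGoodDir hn hΩ hu.2.1)] with x h1 h2 hmem
  obtain ⟨B, hB, hq⟩ := exists_bilinear_of_ae_parallelogram (h1 hmem) (h2 hmem)
  filter_upwards [hq] with ζ hζ
  rw [hζ, inner_toEuclideanLin_of_bilinear B (symGrad_eq_of_ae_bilinear hB hq)]

lemma measurableSet_dirDeriv_eq (hΩ : IsOpen Ω) (hwm : Measurable w) :
    MeasurableSet {p : EuclideanSpace ℝ (Fin n) × EuclideanSpace ℝ (Fin n) | p.1 ∈ Ω →
      dirDeriv w p.2 p.1 = inner ℝ (Matrix.toEuclideanLin (symGrad w p.1) p.2) p.2} := by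
  simp only [imp_iff_not_or, ofPred_or]
  exact (hΩ.measurableSet.preimage measurable_fst).compl.union
    (measurableSet_eq_fun (measurable_dirDeriv hwm measurable_snd measurable_fst)
      (measurable_inner_symGrad hwm measurable_fst measurable_snd))

lemma ae_ae_dirDeriv_eq' (hn : 1 ≤ n) (hΩ : IsOpen Ω) (hwm : Measurable w)
    (hw : ∀ᵐ x, x ∈ Ω → w x = u x) (hu : IsGBVE Ω u) :
    ∀ᵐ ζ, ∀ᵐ x, x ∈ Ω → dirDeriv w ζ x =
      inner ℝ (Matrix.toEuclideanLin (symGrad w x) ζ) ζ := by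
  refine (Measure.ae_ae_comm (measurableSet_dirDeriv_eq hΩ hwm)).1 ?_
  filter_upwards [ae_ae_dirDeriv_eq hn hΩ hwm hw hu] with x hx
  by_cases hmem : x ∈ Ω
  · filter_upwards [hx hmem] with ζ hζ _ using hζ
  · exact Eventually.of_forall fun ζ h => absurd h hmem

lemma ae_ae_hasEssDeriv (hΩ : IsOpen Ω) (hwm : Measurable w)
    (hw : ∀ᵐ x, x ∈ Ω → w x = u x)
    (hdir : ∀ᵐ ζ : EuclideanSpace ℝ (Fin n), ζ ≠ 0 ∧ IsGoodDir Ω u ζ) :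
    ∀ᵐ x, x ∈ Ω → ∀ᵐ ζ, HasEssDeriv w ζ x := by
  have hm : MeasurableSet {p : EuclideanSpace ℝ (Fin n) × EuclideanSpace ℝ (Fin n) |
      p.2 ∈ Ω → HasEssDeriv w p.1 p.2} := by
    simp only [imp_iff_not_or, ofPred_or]
    exact (hΩ.measurableSet.preimage measurable_snd).compl.union (measurableSet_hasEssDeriv hwm)
  have h : ∀ᵐ ζ, ∀ᵐ x, x ∈ Ω → HasEssDeriv w ζ x :=
    hdir.mono fun ζ hζ => hζ.2.ae_hasEssDeriv hΩ hwm hw hζ.1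
  filter_upwards [(Measure.ae_ae_comm hm).1 h] with x hx hmem
  filter_upwards [hx] with ζ hζ using hζ hmem

/-- Essential differentiability along almost every ray yields approximate differentiability. -/
lemma hasApproxLimWithin_of_ae_ray (hwm : Measurable w)
    (hw : ∀ᵐ x, x ∈ Ω → w x = u x) {M : Matrix (Fin n) (Fin n) ℝ} {x : EuclideanSpace ℝ (Fin n)}
    (hx : w x = u x) (h0 : ∀ᵐ ζ : EuclideanSpace ℝ (Fin n), ζ ≠ 0)
    (hess : ∀ᵐ ζ, HasEssDeriv w ζ x)
    (heq : ∀ᵐ ζ, dirDeriv w ζ x = inner ℝ (Matrix.toEuclideanLin M ζ) ζ) :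
    HasApproxLimWithin (fun y => inner ℝ (u y - u x - Matrix.toEuclideanLin M (y - x)) (y - x)
      / ‖y - x‖ ^ 2) Ω x 0 := by
  intro ε hε
  set T := Matrix.toEuclideanLin M with hT
  have hTc : Continuous T := T.continuous_of_finiteDimensional
  set N : Set (EuclideanSpace ℝ (Fin n)) :=
    {v | ε * ‖v‖ ^ 2 < ‖(inner ℝ (w (x + v) - w x - T v) v : ℝ)‖} with hN
  have hNm : MeasurableSet N := by
    have : Measurable T := hTc.measurable
    refine measurableSet_lt (by fun_prop) ?_
    fun_prop
  have hray : ∀ᵐ z : EuclideanSpace ℝ (Fin n), ∃ δ > 0, ∀ᵐ s : ℝ, s ∈ Ioo 0 δ → s • z ∉ N := by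
    filter_upwards [h0, hess, heq] with z hz0 hz hze
    have hpos : 0 < ε * ‖z‖ ^ 2 := by positivity
    obtain ⟨j, hj⟩ := exists_nat_one_div_lt hpos
    obtain ⟨m, hm⟩ := hz j
    refine ⟨1 / ((m : ℝ) + 1), by positivity, ?_⟩
    filter_upwards [hm] with s hs hsm hsN
    have h1 := hs (by rw [abs_of_pos hsm.1]; exact hsm.2)
    rw [hze, abs_of_pos hsm.1] at h1
    have e : (inner ℝ (w (x + s • z) - w x - T (s • z)) (s • z) : ℝ) =
        s * (inner ℝ (w (x + s • z) - w x) z - s * inner ℝ (T z) z) := by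
      rw [map_smul, inner_smul_right, inner_sub_left _ (s • T z), real_inner_smul_left]
    have h2 : ε * ‖s • z‖ ^ 2 < ‖(inner ℝ (w (x + s • z) - w x - T (s • z)) (s • z) : ℝ)‖ := hsN
    rw [e, norm_mul, Real.norm_of_nonneg hsm.1.le, norm_smul, Real.norm_of_nonneg hsm.1.le,
      Real.norm_eq_abs] at h2
    have h3 := mul_le_mul_of_nonneg_left h1 hsm.1.le
    have h4 : s * (1 / ((j : ℝ) + 1) * s) ≤ ε * (s * ‖z‖) ^ 2 := by
      have := mul_le_mul_of_nonneg_right hj.le (sq_nonneg s)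
      nlinarith
    linarith
  have hlim := tendsto_density_zero_of_ae_ray hNm hray
  refine tendsto_of_tendsto_of_tendsto_of_le_of_le tendsto_const_nhds hlim
    (fun _ => zero_le) fun r => ?_
  simp only
  rw [Measure.addHaar_ball_center volume x r]
  gcongr ?_ / _
  rw [← measure_preimage_add volume (-x) (N ∩ Metric.ball 0 r)]
  refine measure_mono_ae ?_
  filter_upwards [hw] with y hy hyS
  obtain ⟨hyΩ, hyb, hyε⟩ := hyS
  change -x + y ∈ N ∩ Metric.ball 0 r
  rw [neg_add_eq_sub]
  refine ⟨?_, by rw [mem_ball_zero_iff, ← dist_eq_norm]; exact hyb⟩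
  rw [sub_zero, ← hy hyΩ, ← hx, abs_div, abs_of_nonneg (sq_nonneg ‖y - x‖)] at hyε
  have hne : 0 < ‖y - x‖ ^ 2 := by
    by_contra hc
    have hz : ‖y - x‖ ^ 2 = 0 := le_antisymm (not_lt.1 hc) (sq_nonneg _)
    rw [hz, div_zero] at hyε
    exact absurd hyε (not_lt.2 hε.le)
  change ε * ‖y - x‖ ^ 2 < ‖(inner ℝ (w (x + (y - x)) - w x - T (y - x)) (y - x) : ℝ)‖
  rw [add_sub_cancel, Real.norm_eq_abs]
  exact (lt_div_iff₀ hne).1 hyε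

end SymGrad

theorem theorem3p3 {n : ℕ} (hn : 1 ≤ n) (Ω : Set (EuclideanSpace ℝ (Fin n))) (hΩ : IsOpen Ω)
    (u : EuclideanSpace ℝ (Fin n) → EuclideanSpace ℝ (Fin n)) (hu : IsGBVE Ω u) :
    ∃ e : EuclideanSpace ℝ (Fin n) → Matrix (Fin n) (Fin n) ℝ,
      (∀ x, (e x).IsSymm) ∧
      (∀ i j, IntegrableOn (fun x => e x i j) Ω) ∧
      (∀ᵐ x ∂(volume.restrict Ω),
        HasApproxLimWithin
          (fun y => inner ℝ (u y - u x - Matrix.toEuclideanLin (e x) (y - x)) (y - x)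
            / ‖y - x‖ ^ 2)
          Ω x 0) ∧
      (∀ᵐ ξ : EuclideanSpace ℝ (Fin n), ξ ≠ 0 →
        ∀ᵐ y : (Submodule.span ℝ {ξ})ᗮ,
          IsBVLoc (sliceFun u ξ y) (sliceSet Ω ξ y) ∧
          ∀ᵐ t ∂(volume.restrict (sliceSet Ω ξ (y : EuclideanSpace ℝ (Fin n)))),
            inner ℝ (Matrix.toEuclideanLin (e ((y : EuclideanSpace ℝ (Fin n)) + t • ξ)) ξ) ξ
              = bvGrad (sliceFun u ξ y) (sliceSet Ω ξ y) t) := by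
  set w := hu.1.mk u with hwdef
  have hwm : Measurable w := hu.1.measurable_mk
  have hw : ∀ᵐ x, x ∈ Ω → w x = u x :=
    (ae_restrict_iff' hΩ.measurableSet).1 (hu.1.ae_eq_mk.mono fun x hx => hx.symm)
  have hdir := ae_isGoodDir hn hΩ hu.2.1
  refine ⟨symGrad w, symGrad_isSymm, integrableOn_symGrad hn hΩ hwm hw hu, ?_, ?_⟩
  · rw [ae_restrict_iff' hΩ.measurableSet]
    filter_upwards [hw, ae_ae_hasEssDeriv hΩ hwm hw hdir, ae_ae_dirDeriv_eq hn hΩ hwm hw hu]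
      with x h1 h2 h3 hmem
    exact hasApproxLimWithin_of_ae_ray hwm hw (h1 hmem) (hdir.mono fun ζ h => h.1) (h2 hmem)
      (h3 hmem)
  · filter_upwards [hdir, ae_ae_dirDeriv_eq' hn hΩ hwm hw hu] with ξ hξ heq hξ0
    filter_upwards [hξ.2, ae_slice_dirDeriv_eq_bvGrad hΩ hw hξ0 hξ.2, ae_slice_of_ae hξ0 heq]
      with y h1 h2 h3
    refine ⟨h1, ?_⟩
    rw [ae_restrict_iff' (isOpen_sliceSet hΩ _ _).measurableSet]
    filter_upwards [h2, h3] with t h4 h5 hmem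
    rw [← h4 hmem, h5 hmem]
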